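/- Let $S$ be a finite set of size $s\ge 2$, let $G$ be an Abelian group, and let $n,d\ge 0$ be integers. A function $S^n\to G$ is a $d$-junta if it depends on at most $d$ of its $n$ coordinates; $\mathcal J_d(S^n,G)$ denotes the set of $d$-junta-sums, i.e. of finite sums of $d$-juntas $S^n\to G$. Write $\delta(f,P)$ for the fraction of points of $S^n$ at which $f$ and $P$ differ. For $q\in\mathbb N$ and $\delta\in\mathbb R$, the family $\mathcal J_d(S^n,G)$ is $(q,\delta)$-locally correctable if there is a randomized (possibly adaptive) algorithm which, given oracle access to a function $f:S^n\to G$ and an input $x\in S^n$, makes at most $q$ queries to $f$ and has the following property: for every $f:S^n\to G$, every $P\in\mathcal J_d(S^n,G)$ with $\delta(f,P)\le\delta$ and every $x\in S^n$, it outputs $P(x)$ with probability at least $3/4$. Theorem. For every $\varepsilon>0$ the following hold. (1) There are constants $C$ and $c$, depending only on $\varepsilon$, such that for every finite set $S$ of size $s\ge 2$, every Abelian group $G$ and all integers $d,n\ge 0$, the family $\mathcal J_d(S^n,G)$ is $\left(q,\frac{1}{2s^d}-\varepsilon\right)$-locally correctable for some $$q\le C\cdot \max(1,\log n)^d\cdot\max(1,\log\log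 n)^{c},$$ that is, with $\widetilde{O}_\varepsilon((\log n)^d)$ queries, where $\widetilde O$ hides powers of $\log\log n$ (for $n\in\{0,1\}$, where a logarithm is undefined, both maxima are read as $1$). (2) For every integer $M\ge 1$ there is a number $q$, depending only on $M$ and $\varepsilon$, such that for every finite set $S$ of size $s\ge 2$, every torsion Abelian group $G$ of exponent $M$ and all integers $d,n\ge 0$, the family $\mathcal J_d(S^n,G)$ is $\left(q,\frac{1}{2s^d}-\varepsilon\right)$-locally correctable. -/

import Mathlib

universe u v

/-- Deterministic adaptive query algorithms (decision trees) for an oracle `f : D → G`.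
Such an algorithm either stops with an answer in `R`, or asks for `f x` at some point `x : D` and
continues in a way that may depend on the value received.  There is no restriction on the
internal computation: the only resource is the number of queries. -/
inductive QueryAlg (D : Type*) (G : Type*) (R : Type*)
  | output (r : R) : QueryAlg D G R
  | query (x : D) (next : G → QueryAlg D G R) : QueryAlg D G R

namespace QueryAlg

/-- The answer produced when the queries are answered by the oracle `f`. -/
def eval {D G R : Type*} (f : D → G) : QueryAlg D G R → R
  | output r => r
  | query x next => eval f (next (f x))

/-- The algorithm makes at most `q` queries, whatever the answers of the oracle are. -/
def MakesAtMost {D G R : Type*} : QueryAlg D G R → ℕ → Prop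
  | output _, _ => True
  | query _ _, 0 => False
  | query _ next, q + 1 => ∀ g, MakesAtMost (next g) q

end QueryAlg

open Classical in
/-- Normalized Hamming distance: the fraction of the points of `D` at which `f` and `P` differ. -/
noncomputable def relHammingDist {D G : Type*} [Fintype D] (f P : D → G) : ℝ :=
  (hammingDist f P : ℝ) / (Fintype.card D : ℝ)

/-- The family `F` of functions `D → G` is `(q, δ)`-locally correctable: there is a randomized
algorithm `A` making at most `q` oracle queries (for every input, a probability distribution on
`q`-query deterministic algorithms) such that, for every `P ∈ F`, every oracle `f` at distance at
most `δ` from `P` and every input `x`, the output of `A` on `x` with oracle `f` is `P x` with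
probability at least `3/4`. -/
def LocallyCorrectable {D G : Type*} [Fintype D] (F : Set (D → G)) (q : ℕ) (δ : ℝ) : Prop :=
  ∃ A : D → PMF (QueryAlg D G G),
    (∀ x, ∀ T ∈ (A x).support, T.MakesAtMost q) ∧
    ∀ f : D → G, ∀ P ∈ F, relHammingDist f P ≤ δ →
      ∀ x, 3 / 4 ≤ ((A x).map (QueryAlg.eval f)) (P x)

/-- `f : S^n → G` is a `d`-junta: it factors through the projection to some set `I` of at most `d`
coordinates. -/
def IsJunta {S G : Type*} {n : ℕ} (d : ℕ) (f : (Fin n → S) → G) : Prop :=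
  ∃ I : Finset (Fin n), I.card ≤ d ∧ ∃ g : (I → S) → G, ∀ a, f a = g fun i => a i

/-- The family of `d`-junta-sums `S^n → G`: finite sums of `d`-juntas. -/
def juntaSums (S G : Type*) [AddCommGroup G] (n d : ℕ) : Set ((Fin n → S) → G) :=
  {f | ∃ (k : ℕ) (h : Fin k → (Fin n → S) → G), (∀ j, IsJunta d (h j)) ∧ f = ∑ j, h j}

/-! Junta-sums are replaced by the class `LowDeg d`, in which all (d+1)-fold differences along
blocks of coordinates vanish. Such a function stays of degree at most d on every subcube z ↦ x + z ∘
h, where coordinates are merged along a map h. If nonzero, it is nonzero on an s^(-d) fraction of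
the points (`LowDeg.card_le_card_support_mul`). Hence a subcube with error fraction below 1/(2 s^d)
decodes uniquely.

Error reduction: decoding on the k-dimensional subcube given by a random h defines a new oracle,
each of whose values costs s^k queries. Points x + z ∘ h and x + z' ∘ h with nearly balanced z - z'
satisfy small-set expansion (`pr_and_le_rpow`), so the error fraction inside the subcube
concentrates. This leads from the unique decoding radius to any small constant distance
(`exists_reduces_const`), and from a small τ to τ^(5/4) (`exists_reduces_rpow`), each with O(1)
queries. Iterating the second step reaches distance of order (log n)^(-d) at the cost of a power of
log log n.

Final correction (`corrects_of_interpolation`): each coordinate receives a random position and a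
random nonzero shift. A set A of positions gives the point obtained from x by shifting the
coordinates positioned in A. Along these points P is a set function of degree at most d with value P
x at ∅, and the point of A is nearly uniform when A has density close to 1 - 1/s. What is needed is
a small family of such sets whose values determine the value at ∅; a union bound then excludes
errors. For exponent M, one slice of a ground set of bounded size suffices
(`SetDeg.eq_zero_of_slice`). In general, positions carry binary weights, and unions of at most d
carry moves, O((log n)^d) in number, suffice (`SetDeg.eq_zero_of_conf`).

Constants are uniform because the radius is negative for all but finitely many (s, d) with d > 0;
for d = 0 a majority vote works for every s. -/

namespace JuntaCorrection

/-! ### Functions of degree at most d on a grid. -/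

open Classical in
/-- Functions all of whose `(d+1)`-fold discrete derivatives vanish, a derivative being taken by
fixing a set of coordinates in two ways. -/
def LowDeg {ι A G : Type*} [AddCommGroup G] : ℕ → ((ι → A) → G) → Prop
  | 0, Q => ∀ z z', Q z = Q z'
  | d + 1, Q => ∀ (m : Set ι) (τ τ' : ι → A),
      LowDeg d fun z => Q (m.piecewise τ z) - Q (m.piecewise τ' z)

section LowDeg

variable {ι κ A B G : Type*} [AddCommGroup G]

lemma LowDeg.zero (d : ℕ) : LowDeg d (fun _ : ι → A => (0 : G)) := by
  induction d with
  | zero => intro z z'; rfl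
  | succ d ih => intro m τ τ'; simpa using ih

lemma LowDeg.add {d : ℕ} {Q R : (ι → A) → G} (hQ : LowDeg d Q) (hR : LowDeg d R) :
    LowDeg d (fun z => Q z + R z) := by
  induction d generalizing Q R with
  | zero => intro z z'; simp only [hQ z z', hR z z']
  | succ d ih =>
    intro m τ τ'
    convert ih (hQ m τ τ') (hR m τ τ') using 2
    exact add_sub_add_comm _ _ _ _

lemma LowDeg.sub {d : ℕ} {Q R : (ι → A) → G} (hQ : LowDeg d Q) (hR : LowDeg d R) :
    LowDeg d (fun z => Q z - R z) := by
  induction d generalizing Q R with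
  | zero => intro z z'; simp only [hQ z z', hR z z']
  | succ d ih =>
    intro m τ τ'
    convert ih (hQ m τ τ') (hR m τ τ') using 2
    exact sub_sub_sub_comm _ _ _ _

/-- A block m meeting I leaves a difference that depends on fewer coordinates; a block missing I
leaves the difference zero. -/
lemma LowDeg.of_dependsOn {d : ℕ} {Q : (ι → A) → G} (I : Finset ι) (hI : I.card ≤ d)
    (hQ : DependsOn Q (I : Set ι)) : LowDeg d Q := by
  classical
  induction d generalizing Q I with
  | zero =>
    intro z z'
    apply hQ
    intro i hi
    simp [Finset.card_eq_zero.mp (Nat.le_zero.mp hI)] at hi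
  | succ d ih =>
    intro m τ τ'
    by_cases hm : ∃ i ∈ I, i ∈ m
    · obtain ⟨i, hi, him⟩ := hm
      refine ih (I.filter (· ∉ m)) ?_ ?_
      · have : I.filter (· ∉ m) ⊆ I.erase i := by
          intro j hj
          rw [Finset.mem_filter] at hj
          refine Finset.mem_erase.mpr ⟨?_, hj.1⟩
          rintro rfl
          exact hj.2 him
        have := Finset.card_le_card this
        rw [Finset.card_erase_of_mem hi] at this
        omega
      · intro z z' h
        have key : ∀ σ : ι → A, Q (m.piecewise σ z) = Q (m.piecewise σ z') := by
          intro σ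
          apply hQ
          intro j hj
          by_cases hjm : j ∈ m
          · simp [hjm]
          · simp only [Set.piecewise, hjm, if_false]
            exact h j (by simpa [hjm] using hj)
        simp only [key]
    · push Not at hm
      have : (fun z => Q (m.piecewise τ z) - Q (m.piecewise τ' z)) = fun _ => 0 := by
        funext z
        rw [sub_eq_zero]
        apply hQ
        intro j hj
        simp [hm j hj]
      rw [this]
      exact LowDeg.zero d

/-- A difference along m pulls back to one along `h ⁻¹' m`. Since blocks are arbitrary sets, `h` may
merge coordinates; this is what permits restriction to the subcubes z ↦ x + z ∘ h. -/
lemma LowDeg.comp {d : ℕ} {Q : (ι → A) → G} (hQ : LowDeg d Q) (h : ι → κ) (ψ : ι → B → A) :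
    LowDeg d (fun z : κ → B => Q fun i => ψ i (z (h i))) := by
  classical
  induction d generalizing Q with
  | zero => intro z z'; exact hQ _ _
  | succ d ih =>
    intro m τ τ'
    convert ih (hQ (h ⁻¹' m) (fun i => ψ i (τ (h i))) (fun i => ψ i (τ' (h i)))) using 4
    all_goals
      funext i
      by_cases hi : h i ∈ m <;> simp [Set.piecewise, hi]

lemma lowDeg_of_mem_juntaSums {S : Type*} {n d : ℕ} {f : (Fin n → S) → G}
    (hf : f ∈ juntaSums S G n d) : LowDeg d f := by
  obtain ⟨k, h, hh, rfl⟩ := hf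
  have key : ∀ s : Finset (Fin k), LowDeg d (∑ j ∈ s, h j) := by
    classical
    intro s
    induction s using Finset.induction_on with
    | empty => exact LowDeg.zero d
    | insert j s hj ih =>
      rw [Finset.sum_insert hj]
      refine LowDeg.add ?_ ih
      obtain ⟨I, hI, g, hg⟩ := hh j
      refine LowDeg.of_dependsOn I hI ?_
      intro z z' hz
      rw [hg, hg]
      congr 1
      funext i
      exact hz i i.2
  exact key _

lemma eq_of_forall_update [Finite ι] [DecidableEq ι] {R : Type*} {Q : (ι → A) → R}
    (h : ∀ z i a, Q (Function.update z i a) = Q z) (z z' : ι → A) : Q z = Q z' := by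
  have := Fintype.ofFinite ι
  have key : ∀ s : Finset ι, Q (s.piecewise z z') = Q z' := by
    intro s
    induction s using Finset.induction_on with
    | empty => simp
    | insert i s hi ih => rw [Finset.piecewise_insert, h, ih]
  simpa using key Finset.univ

/-- A nonzero function of degree at most `d` on a finite grid with side `s` is nonzero on at least
an `s ^ (-d)` fraction of the points. -/
lemma LowDeg.card_le_card_support_mul [Fintype ι] [DecidableEq ι] [Fintype A] [Nonempty A] {d : ℕ}
    {Q : (ι → A) → G}
    (hQ : LowDeg d Q) (hne : ∃ z, Q z ≠ 0) :
    Nat.card (ι → A) ≤ Nat.card {z // Q z ≠ 0} * Fintype.card A ^ d := by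
  classical
  induction d generalizing Q with
  | zero =>
    obtain ⟨z, hz⟩ := hne
    have : ∀ z', Q z' ≠ 0 := fun z' => by rwa [hQ z' z]
    simp [this]
  | succ d ih =>
    by_cases hc : ∃ z i a, Q (Function.update z i a) ≠ Q z
    · obtain ⟨z, i, a, hz⟩ := hc
      -- The difference between two values of one coordinate is nonzero at z and has degree one
      -- less. Wherever it is nonzero, some point on the line in direction i supports Q.
      have hD : LowDeg d fun w =>
          Q (Function.update w i a) - Q (Function.update w i (z i)) := by
        convert hQ {i} (fun _ => a) (fun _ => z i) using 4 <;>
        · funext j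
          by_cases hj : j = i
          · subst hj; simp
          · simp [hj]
      have h1 := ih hD ⟨z, by simpa [sub_eq_zero] using hz⟩
      have h2 : Nat.card {w // Q (Function.update w i a) - Q (Function.update w i (z i)) ≠ 0}
          ≤ Nat.card ({w // Q w ≠ 0} × A) := by
        have hsel : ∀ w : {w // Q (Function.update w i a) - Q (Function.update w i (z i)) ≠ 0},
            ∃ b, Q (Function.update w.1 i b) ≠ 0 := by
          rintro ⟨w, hw⟩
          by_contra! hcon
          exact hw (by simp [hcon])
        choose b hb using hsel
        -- The chosen point forgets only the coordinate `w i`, so recording it costs one factor s.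
        refine Nat.card_le_card_of_injective (fun w => (⟨_, hb w⟩, w.1 i)) ?_
        intro w w' hww
        simp only [Prod.mk.injEq, Subtype.mk.injEq] at hww
        apply Subtype.ext
        funext j
        by_cases hj : j = i
        · subst hj; exact hww.2
        · have := congrFun hww.1 j
          simpa [hj] using this
      rw [Nat.card_prod, Nat.card_eq_fintype_card (α := A)] at h2
      calc Nat.card (ι → A) ≤ _ := h1
        _ ≤ (Nat.card {w // Q w ≠ 0} * Fintype.card A) * Fintype.card A ^ d := by gcongr
        _ = _ := by ring
    · push Not at hc
      obtain ⟨z, hz⟩ := hne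
      have : ∀ z', Q z' ≠ 0 := fun z' => by rwa [eq_of_forall_update hc z' z]
      have hA : 1 ≤ Fintype.card A ^ (d + 1) :=
        Nat.one_le_pow _ _ Fintype.card_pos
      rw [Nat.card_congr (Equiv.subtypeUnivEquiv this)]
      exact Nat.le_mul_of_pos_right _ hA

end LowDeg

/-! ### Degree of set functions. -/

/-- The analogue of `LowDeg` for functions of a finite set. -/
def SetDeg {α G : Type*} [DecidableEq α] [AddCommGroup G] : ℕ → (Finset α → G) → Prop
  | 0, q => ∀ A B, q A = q B
  | d + 1, q => ∀ m X Y : Finset α, X ⊆ m → Y ⊆ m →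
      SetDeg d fun A => q ((A \ m) ∪ X) - q ((A \ m) ∪ Y)

section SetDeg

variable {ι S α G : Type*} [DecidableEq α] [AddCommGroup G]

lemma SetDeg.const (d : ℕ) (g : G) : SetDeg d (fun _ : Finset α => g) := by
  induction d generalizing g with
  | zero => intro z z'; rfl
  | succ d ih => intro m X Y _ _; simpa using ih 0

lemma SetDeg.sub {d : ℕ} {q r : Finset α → G} (hq : SetDeg d q) (hr : SetDeg d r) :
    SetDeg d (fun z => q z - r z) := by
  induction d generalizing q r with
  | zero => intro z z'; simp only [hq z z', hr z z']
  | succ d ih =>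
    intro m X Y hX hY
    convert ih (hq m X Y hX hY) (hr m X Y hX hY) using 2
    exact sub_sub_sub_comm _ _ _ _

/-- Recentring at u: fixing A on m to X fixes `symmDiff u A` on m to `symmDiff u X ∩ m`. -/
lemma SetDeg.comp_symmDiff {d : ℕ} {q : Finset α → G} (hq : SetDeg d q) (u : Finset α) :
    SetDeg d (fun A => q (symmDiff u A)) := by
  induction d generalizing q with
  | zero => intro z z'; exact hq _ _
  | succ d ih =>
    intro m X Y hX hY
    convert ih (hq m (symmDiff u X ∩ m) (symmDiff u Y ∩ m) Finset.inter_subset_right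
      Finset.inter_subset_right) using 4
    · ext i; have := @hX i; simp only [Finset.mem_symmDiff, Finset.mem_union, Finset.mem_sdiff,
        Finset.mem_inter]; tauto
    · ext i; have := @hY i; simp only [Finset.mem_symmDiff, Finset.mem_union, Finset.mem_sdiff,
        Finset.mem_inter]; tauto

lemma LowDeg.setDeg {d : ℕ} {Q : (ι → S) → G} (hQ : LowDeg d Q) (h : ι → α) (σ τ : ι → S) :
    SetDeg d (fun A : Finset α => Q fun i => if h i ∈ A then τ i else σ i) := by
  classical
  induction d generalizing Q with
  | zero => intro z z'; exact hQ _ _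
  | succ d ih =>
    intro m X Y hX hY
    convert ih (hQ (h ⁻¹' m) (fun i => if h i ∈ X then τ i else σ i)
      (fun i => if h i ∈ Y then τ i else σ i)) using 4
    · funext i
      have := @hX (h i)
      by_cases hi : h i ∈ m
      · simp [hi]
      · have : h i ∉ X := fun hh => hi (this hh)
        simp [hi, this]
    · funext i
      have := @hY (h i)
      by_cases hi : h i ∈ m
      · simp [hi]
      · have : h i ∉ Y := fun hh => hi (this hh)
        simp [hi, this]

end SetDeg

end JuntaCorrection

namespace JuntaCorrection

/-! ### Vanishing propagated from one slice, in bounded exponent. -/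

section Slice

variable {α G : Type*} [Fintype α] [DecidableEq α] [AddCommGroup G]

/-- The number of spare elements that the induction on the degree in `SetDeg.eq_zero_of_slice`
consumes. -/
def sliceRoom (M : ℕ) : ℕ → ℕ
  | 0 => 0
  | d + 1 => sliceRoom M d + M ^ d + 1

/-- A function of degree at most `d` into a group of exponent dividing `M` that vanishes on the
sets of size `w` vanishes on all sets whose size is congruent to `w` modulo `M ^ d`. -/
lemma SetDeg.eq_zero_of_slice {M : ℕ} (hM : 0 < M) (hG : ∀ g : G, M • g = 0) {d : ℕ}
    {q : Finset α → G} (hq : SetDeg d q) (F : Finset α) {w : ℕ} (hw : d ≤ w)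
    (hroom : w + sliceRoom M d ≤ Fᶜ.card)
    (hz : ∀ A, Disjoint A F → A.card = w → q A = 0)
    {A : Finset α} (hA : Disjoint A F) (hAw : A.card ≡ w [MOD M ^ d]) : q A = 0 := by
  induction d generalizing q F w A with
  | zero =>
    obtain ⟨B, hB, hBw⟩ := Finset.exists_subset_card_eq (s := Fᶜ) (n := w) (by omega)
    rw [hq A B]
    exact hz B (Finset.subset_compl_iff_disjoint_right.mp hB) hBw
  | succ d ih =>
    simp only [sliceRoom] at hroom
    set L := M ^ d with hL
    have hLpos : 0 < L := by positivity
    have hmod : ∀ {B : Finset α}, B.card ≡ w [MOD M ^ (d + 1)] → B.card ≡ w [MOD L] :=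
      fun h => h.of_dvd (pow_dvd_pow M (Nat.le_succ d))
    have hcard : ∀ E : Finset α, Fᶜ.card ≤ (F ∪ E)ᶜ.card + E.card := by
      intro E
      have h1 := Finset.card_union_le F E
      have h2 := Finset.card_add_card_compl F
      have h3 := Finset.card_add_card_compl (F ∪ E)
      omega
    -- The difference between adding p and adding p' has lower degree and vanishes on the slice w -
    -- 1, so the induction hypothesis applies. Removing two elements while w drops by one costs one
    -- unit of room.
    have hswap : ∀ (A : Finset α) (p p' : α), Disjoint A F → p ∉ A → p' ∉ A → p ∉ F → p' ∉ F →
        p ≠ p' → A.card + 1 ≡ w [MOD L] → q (insert p A) = q (insert p' A) := by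
      intro A p p' hAF hp hp' hpF hp'F hne hAw
      have key : ∀ B : Finset α, p ∉ B → p' ∉ B →
          q ((B \ {p, p'}) ∪ {p}) - q ((B \ {p, p'}) ∪ {p'}) = q (insert p B) - q (insert p' B) := by
        intro B h1 h2
        have : B \ {p, p'} = B := by
          rw [Finset.sdiff_eq_self_iff_disjoint]
          simp [h1, h2]
        simp only [this, Finset.union_singleton]
      have hd := hq {p, p'} {p} {p'} (by simp) (by simp)
      have h2 : ({p, p'} : Finset α).card = 2 := Finset.card_pair hne
      have hc := hcard {p, p'}
      have := ih hd (F ∪ {p, p'}) (w := w - 1) (by omega) (by omega) ?_ (A := A) ?_ ?_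
      · rwa [key A hp hp', sub_eq_zero] at this
      · intro B hB hBw
        simp only [Finset.disjoint_union_right, Finset.disjoint_insert_right,
          Finset.disjoint_singleton_right] at hB
        rw [key B hB.2.1 hB.2.2, hz, hz, sub_zero]
        · simp [hB.1, hp'F]
        · rw [Finset.card_insert_of_notMem hB.2.2]; omega
        · simp [hB.1, hpF]
        · rw [Finset.card_insert_of_notMem hB.2.1]; omega
      · simp [hAF, hp, hp']
      · apply Nat.ModEq.add_right_cancel' 1
        rwa [Nat.sub_add_cancel (by omega)]
    have hconst : ∀ (k : ℕ) (A B : Finset α), (A \ B).card = k → Disjoint A F → Disjoint B F →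
        A.card = B.card → A.card ≡ w [MOD L] → q A = q B := by
      intro k
      induction k with
      | zero =>
        intro A B h0 _ _ hc _
        rw [Finset.card_eq_zero, Finset.sdiff_eq_empty_iff_subset] at h0
        rw [Finset.eq_of_subset_of_card_le h0 hc.ge]
      | succ k ihk =>
        intro A B hk hA hB hc hAw
        obtain ⟨p, hp⟩ := Finset.card_pos.mp (by omega : 0 < (A \ B).card)
        obtain ⟨p', hp'⟩ := Finset.card_pos.mp
          (by rw [← Finset.card_sdiff_comm hc]; omega : 0 < (B \ A).card)
        have hpe := hp
        rw [Finset.mem_sdiff] at hp hp'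
        have hne : p ≠ p' := fun h => hp'.2 (h ▸ hp.1)
        have hpF : p ∉ F := Finset.disjoint_left.mp hA hp.1
        have hp'F : p' ∉ F := Finset.disjoint_left.mp hB hp'.1
        have hAe : Disjoint (A.erase p) F := hA.mono_left (Finset.erase_subset _ _)
        have hpos : 0 < A.card := Finset.card_pos.mpr ⟨p, hp.1⟩
        have hce : (A.erase p).card + 1 = A.card := by
          rw [Finset.card_erase_of_mem hp.1]; omega
        have hp'e : p' ∉ A.erase p := fun h => hp'.2 (Finset.mem_of_mem_erase h)
        have h1 := hswap (A.erase p) p p' hAe (by simp) hp'e hpF hp'F hne (by rwa [hce])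
        rw [Finset.insert_erase hp.1] at h1
        rw [h1]
        have hci : (insert p' (A.erase p)).card = A.card := by
          rw [Finset.card_insert_of_notMem hp'e, hce]
        apply ihk _ _ _ _ hB (by rw [hci, hc]) (by rwa [hci])
        · have : insert p' (A.erase p) \ B = (A \ B).erase p := by
            ext i
            simp only [Finset.mem_sdiff, Finset.mem_insert, Finset.mem_erase]
            constructor
            · rintro ⟨rfl | h, h'⟩
              · exact absurd hp'.1 h'
              · exact ⟨h.1, h.2, h'⟩
            · rintro ⟨h, h', h''⟩
              exact ⟨Or.inr ⟨h, h'⟩, h''⟩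
          rw [this, Finset.card_erase_of_mem hpe]
          omega
        · simp [hAe, hp'F]
    obtain ⟨B₁, hB₁, hB₁w⟩ := Finset.exists_subset_card_eq (s := Fᶜ) (n := w + L) (by omega)
    have hB₁F := Finset.subset_compl_iff_disjoint_right.mp hB₁
    -- By `hconst`, adding a block of L elements to a set of size w always yields the value `q B₁`.
    -- So the difference along E minus this constant vanishes on the slice w, hence on all sizes
    -- congruent to w modulo L.
    have hκ : ∀ A E : Finset α, Disjoint A F → Disjoint E F → Disjoint A E → E.card = L →
        A.card ≡ w [MOD L] → q (A ∪ E) = q A + q B₁ := by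
      intro A E hA hE hAE hEL hAw
      have hd := (hq E E ∅ subset_rfl (by simp)).sub (SetDeg.const d (q B₁))
      have hc := hcard E
      have := ih hd (F ∪ E) (w := w) (by omega) (by omega) ?_ (A := A) ?_ hAw
      · simp only [Finset.sdiff_eq_self_of_disjoint hAE, Finset.union_empty] at this
        rw [sub_eq_zero, sub_eq_iff_eq_add] at this
        rw [this, add_comm]
      · intro B hB hBw
        rw [Finset.disjoint_union_right] at hB
        simp only [Finset.sdiff_eq_self_of_disjoint hB.2, Finset.union_empty]
        have hcu : (B ∪ E).card = w + L := by rw [Finset.card_union_of_disjoint hB.2, hBw, hEL]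
        rw [hz B hB.1 hBw, hconst _ (B ∪ E) B₁ rfl (Finset.disjoint_union_left.mpr ⟨hB.1, hE⟩)
          hB₁F (by rw [hcu, hB₁w]) (by rw [hcu]; simp [Nat.ModEq])]
        simp
      · exact Finset.disjoint_union_right.mpr ⟨hA, hAE⟩
    have hchain : ∀ (i : ℕ) (A A' : Finset α), A ⊆ A' → Disjoint A' F → A'.card = A.card + i * L →
        A.card ≡ w [MOD L] → q A' = q A + i • q B₁ := by
      intro i
      induction i with
      | zero =>
        intro A A' hs _ hc _
        rw [Finset.eq_of_subset_of_card_le hs (by omega)]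
        simp
      | succ i ihi =>
        intro A A' hs hF hc hAw
        have hc' : A'.card = A.card + i * L + L := by rw [hc]; ring
        obtain ⟨B, hAB, hBA, hBc⟩ := Finset.exists_subsuperset_card_eq hs
          (Nat.le_add_right A.card (i * L)) (by omega)
        have hBF := hF.mono_left hBA
        have h1 := ihi A B hAB hBF hBc hAw
        have h2 := hκ B (A' \ B) hBF (hF.mono_left Finset.sdiff_subset)
          Finset.disjoint_sdiff (by rw [Finset.card_sdiff_of_subset hBA]; omega)
          (by rw [hBc]; simpa [Nat.ModEq] using hAw)
        rw [Finset.union_sdiff_of_subset hBA] at h2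
        rw [h2, h1, succ_nsmul]
        abel
    -- Sizes congruent modulo M^(d+1) differ by a multiple of M blocks, whose total contribution is
    -- killed by the exponent.
    have hzero : ∀ j : ℕ, (j * M) • q B₁ = 0 := fun j => by rw [mul_nsmul', hG, nsmul_zero]
    have hAL := hmod hAw
    rcases le_total A.card w with hle | hle
    · obtain ⟨A', hAA', hA'F, hA'c⟩ := Finset.exists_subsuperset_card_eq
        (Finset.subset_compl_iff_disjoint_right.mpr hA) hle (by omega)
      obtain ⟨j, hj⟩ := (Nat.modEq_iff_dvd' hle).mp hAw
      have h := hchain (j * M) A A' hAA' (Finset.subset_compl_iff_disjoint_right.mp hA'F)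
        (by rw [hA'c, hL]; have : j * M * M ^ d = M ^ (d + 1) * j := by ring
            omega) hAL
      rw [hz A' (Finset.subset_compl_iff_disjoint_right.mp hA'F) hA'c, hzero, add_zero] at h
      exact h.symm
    · obtain ⟨A', hA'A, hA'c⟩ := Finset.exists_subset_card_eq hle
      obtain ⟨j, hj⟩ := (Nat.modEq_iff_dvd' hle).mp hAw.symm
      have h := hchain (j * M) A' A hA'A hA
        (by rw [hA'c, hL]; have : j * M * M ^ d = M ^ (d + 1) * j := by ring
            omega) (by rw [hA'c])
      rw [h, hz A' (hA.mono_left hA'A) hA'c, hzero, add_zero]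

end Slice

/-! ### Binary weights, carry moves and their interpolation property. -/

section Scale

variable {E G : Type*} [DecidableEq E] [AddCommGroup G] {t : ℕ}

/-- An elementary move: it flips one position at some scale and two positions of the opposite
value at the next scale, or a single position at the last scale. -/
def IsMove (bit : E → Bool) (m : Finset (Fin (t + 1) × E)) : Prop :=
  (∃ e, m = {(Fin.last t, e)}) ∨ ∃ (j : Fin t) (e e' e'' : E), e' ≠ e'' ∧ bit e' = !bit e ∧
    bit e'' = !bit e ∧ m = {(j.castSucc, e), (j.succ, e'), (j.succ, e'')}

/-- `Conf bit d F A`: the set `A` is a union of at most `d` disjoint moves that avoid `F`. -/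
inductive Conf (bit : E → Bool) : ℕ → Finset (Fin (t + 1) × E) → Finset (Fin (t + 1) × E) → Prop
  | empty (d : ℕ) (F : Finset (Fin (t + 1) × E)) : Conf bit d F ∅
  | move (d : ℕ) (F m A : Finset (Fin (t + 1) × E)) (hm : IsMove bit m) (hmF : Disjoint m F)
      (hA : Conf bit d (F ∪ m) A) : Conf bit (d + 1) F (m ∪ A)

variable {bit : E → Bool}

lemma Conf.mono {d : ℕ} {F A : Finset (Fin (t + 1) × E)} (h : Conf bit d F A) {d' : ℕ}
    (hd : d ≤ d') {F' : Finset (Fin (t + 1) × E)} (hF : F' ⊆ F) : Conf bit d' F' A := by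
  induction h generalizing d' F' with
  | empty d F => exact Conf.empty _ _
  | move d F m A hm hmF hA ih =>
    obtain ⟨d', rfl⟩ := Nat.exists_eq_add_of_le' (show 1 ≤ d' by omega)
    exact Conf.move _ _ _ _ hm (hmF.mono_right hF)
      (ih (by omega) (Finset.union_subset_union_left hF))

lemma Conf.disjoint {d : ℕ} {F A : Finset (Fin (t + 1) × E)} (h : Conf bit d F A) :
    Disjoint A F := by
  induction h with
  | empty d F => simp
  | move d F m A hm hmF hA ih =>
    exact Finset.disjoint_union_left.mpr ⟨hmF, (Finset.disjoint_union_right.mp ih).1⟩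

lemma IsMove.card_le {m : Finset (Fin (t + 1) × E)} (hm : IsMove bit m) : m.card ≤ 3 := by
  rcases hm with ⟨e, rfl⟩ | ⟨j, e, e', e'', -, -, -, rfl⟩
  · simp
  · exact Finset.card_le_three

/-- A function of degree at most `d` that vanishes on all unions of at most `d` disjoint moves
vanishes identically. -/
lemma SetDeg.eq_zero_of_conf [Fintype E] {d : ℕ} {q : Finset (Fin (t + 1) × E) → G}
    (hq : SetDeg d q)
    (F : Finset (Fin (t + 1) × E))
    (hF : ∀ b, F.card + 3 * d ≤ (Finset.univ.filter fun e => bit e = b).card)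
    (hz : ∀ A, Conf bit d F A → q A = 0) {J : Finset (Fin (t + 1) × E)} (hJ : Disjoint J F) :
    q J = 0 := by
  induction d generalizing q F J with
  | zero => rw [hq J ∅]; exact hz _ (Conf.empty _ _)
  | succ d ih =>
    -- The difference along m has lower degree and vanishes on the unions of d moves avoiding `F ∪
    -- m`; a move takes at most 3 positions, which accounts for the room 3 * d.
    have hmove : ∀ m, IsMove bit m → Disjoint m F → ∀ J, Disjoint J F → Disjoint J m →
        q (J ∪ m) = q J := by
      intro m hm hmF J hJF hJm
      have hmc := hm.card_le
      have huc := Finset.card_union_le F m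
      have := ih (hq m m ∅ subset_rfl (by simp)) (F ∪ m)
        (fun b => by have := hF b; omega) ?_ (J := J) (Finset.disjoint_union_right.mpr ⟨hJF, hJm⟩)
      · rwa [Finset.sdiff_eq_self_of_disjoint hJm, Finset.union_empty, sub_eq_zero] at this
      · intro A hA
        rw [Finset.sdiff_eq_self_of_disjoint (Finset.disjoint_union_right.mp hA.disjoint).2,
          Finset.union_empty, hz A (hA.mono (by omega) Finset.subset_union_left),
          Finset.union_comm, hz _ (Conf.move _ _ _ _ hm hmF hA), sub_zero]
    -- Downward along the scales: a move is a single position at the last scale, and elsewhere its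
    -- two positions at the next scale are already known to be free.
    have hind : ∀ (j : Fin (t + 1)) (e : E), (j, e) ∉ F → ∀ J, Disjoint J F →
        q (insert (j, e) J) = q J := by
      intro j
      induction j using Fin.reverseInduction with
      | last =>
        intro e heF J hJF
        by_cases heJ : (Fin.last t, e) ∈ J
        · rw [Finset.insert_eq_of_mem heJ]
        · rw [← Finset.union_singleton]
          exact hmove _ (Or.inl ⟨e, rfl⟩) (by simpa using heF) J hJF (by simpa using heJ)
      | cast j ihj =>
        intro e heF J hJF
        by_cases heJ : (j.castSucc, e) ∈ J
        · rw [Finset.insert_eq_of_mem heJ]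
        have havail : 1 < (Finset.univ.filter fun e' => bit e' = (!bit e) ∧ (j.succ, e') ∉ F).card := by
          have h1 := hF (!bit e)
          have h2 : (Finset.univ.filter fun e' => (j.succ, e') ∈ F).card ≤ F.card := by
            refine Finset.card_le_card_of_injOn (fun e' => (j.succ, e')) ?_ ?_
            · intro e' he'; simpa using he'
            · intro a _ b _ hab; simpa using hab
          have h3 : (Finset.univ.filter fun e' => bit e' = (!bit e)) ⊆
              (Finset.univ.filter fun e' => bit e' = (!bit e) ∧ (j.succ, e') ∉ F) ∪
              (Finset.univ.filter fun e' => (j.succ, e') ∈ F) := by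
            intro e' he'
            simp only [Finset.mem_filter, Finset.mem_univ, true_and, Finset.mem_union] at he' ⊢
            tauto
          have h4 := (Finset.card_le_card h3).trans (Finset.card_union_le _ _)
          omega
        obtain ⟨e', he', e'', he'', hne⟩ := Finset.one_lt_card.mp havail
        simp only [Finset.mem_filter, Finset.mem_univ, true_and] at he' he''
        have hcs : j.castSucc ≠ j.succ := (Fin.castSucc_lt_succ).ne
        -- Both next-scale positions may be inserted whether or not J contains them, so J with and
        -- without the new position is compared through `J \ m` with and without m.
        have hadd : ∀ K, Disjoint K F →
            q (insert (j.succ, e') (insert (j.succ, e'') K)) = q K := by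
          intro K hK
          rw [ihj e' he'.2 _ (by simp [hK, he''.2]), ihj e'' he''.2 _ hK]
        set m : Finset (Fin (t + 1) × E) := {(j.castSucc, e), (j.succ, e'), (j.succ, e'')} with hm
        have hJ0 : Disjoint (J \ m) F := hJF.mono_left Finset.sdiff_subset
        have h1 := hmove m (Or.inr ⟨j, e, e', e'', hne, he'.1, he''.1, hm⟩)
          (by simp [hm, heF, he'.2, he''.2]) (J \ m) hJ0 Finset.sdiff_disjoint
        rw [← hadd (insert (j.castSucc, e) J) (by simp [hJF, heF])]
        rw [← hadd (J \ m) hJ0] at h1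
        rw [← hadd J hJF]
        convert h1 using 2
        · ext i
          simp only [hm, Finset.mem_insert, Finset.mem_union, Finset.mem_sdiff,
            Finset.mem_singleton]
          tauto
        · ext i
          simp only [hm, Finset.mem_insert, Finset.mem_sdiff, Finset.mem_singleton]
          by_cases hi : i = (j.castSucc, e)
          · subst hi; simp [hcs, heJ]
          · tauto
    have hall : ∀ J, Disjoint J F → q J = q ∅ := by
      intro J
      induction J using Finset.induction_on with
      | empty => intro _; rfl
      | insert p J hp ihJ =>
        intro hJ
        rw [Finset.disjoint_insert_left] at hJ
        rw [hind p.1 p.2 hJ.1 J hJ.2, ihJ hJ.2]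
    rw [hall J hJ]
    exact hz _ (Conf.empty _ _)

/-- The signed change of the weight caused by flipping a position. -/
def flipWeight (bit : E → Bool) (p : Fin (t + 1) × E) : ℤ :=
  if bit p.2 then -2 ^ (t - p.1) else 2 ^ (t - p.1)

/-- The carry 2^(t-j) = 2 * 2^(t-j-1), with opposite signs, cancels exactly; only flips at the last
scale, of weight one, change the total. -/
lemma IsMove.abs_sum_flipWeight_le {m : Finset (Fin (t + 1) × E)} (hm : IsMove bit m) :
    |∑ p ∈ m, flipWeight bit p| ≤ 1 := by
  rcases hm with ⟨e, rfl⟩ | ⟨j, e, e', e'', hne, h', h'', rfl⟩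
  · cases h : bit e <;> simp [flipWeight, h]
  · have hcs : j.castSucc ≠ j.succ := (Fin.castSucc_lt_succ).ne
    rw [Finset.sum_insert (by simp [hcs]), Finset.sum_pair (by simpa using hne)]
    have hp : (2 : ℤ) ^ (t - (j : ℕ)) = 2 * 2 ^ (t - (j + 1 : ℕ)) := by
      rw [← pow_succ']
      congr 1
      have := j.2
      omega
    cases h : bit e <;> simp [flipWeight, h, h', h'', hp] <;> ring_nf <;> simp

lemma Conf.abs_sum_flipWeight_le {d : ℕ} {F A : Finset (Fin (t + 1) × E)} (h : Conf bit d F A) :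
    |∑ p ∈ A, flipWeight bit p| ≤ d := by
  induction h with
  | empty d F => simp
  | move d F m A hm hmF hA ih =>
    rw [Finset.sum_union (Finset.disjoint_union_right.mp hA.disjoint).2.symm]
    have h1 := hm.abs_sum_flipWeight_le
    have h2 := abs_add_le (∑ p ∈ m, flipWeight bit p) (∑ p ∈ A, flipWeight bit p)
    push_cast
    linarith

/-- A move is encoded by a scale and three elements of E; adding ∅ to the list lets exactly d
factors represent at most d moves. The bound becomes both the query count and the union bound
factor. -/
lemma exists_finset_conf [Fintype E] (bit : E → Bool) (t d : ℕ) :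
    ∃ Z : Finset (Finset (Fin (t + 1) × E)), (∀ F A, Conf bit d F A → A ∈ Z) ∧
      Z.card ≤ ((t + 1) * Fintype.card E ^ 3 + 1) ^ d := by
  classical
  let f : Fin (t + 1) × E × E × E → Finset (Fin (t + 1) × E) := fun x =>
    if x.1 = Fin.last t then {(Fin.last t, x.2.1)} else
      {(x.1, x.2.1), (x.1 + 1, x.2.2.1), (x.1 + 1, x.2.2.2)}
  set N := insert ∅ (Finset.univ.image f) with hN
  have hNc : N.card ≤ (t + 1) * Fintype.card E ^ 3 + 1 := by
    refine (Finset.card_insert_le _ _).trans (Nat.succ_le_succ (Finset.card_image_le.trans ?_))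
    simp only [Finset.card_univ, Fintype.card_prod, Fintype.card_fin]
    apply le_of_eq
    ring
  have hmem : ∀ m, IsMove bit m → m ∈ N := by
    intro m hm
    refine Finset.mem_insert_of_mem (Finset.mem_image.mpr ?_)
    rcases hm with ⟨e, rfl⟩ | ⟨j, e, e', e'', hne, h', h'', rfl⟩
    · exact ⟨(Fin.last t, e, e, e), Finset.mem_univ _, by simp [f]⟩
    · refine ⟨(j.castSucc, e, e', e''), Finset.mem_univ _, ?_⟩
      simp [f, (Fin.castSucc_lt_last j).ne]
  induction d with
  | zero =>
    refine ⟨{∅}, ?_, by simp⟩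
    intro F A hA
    cases hA
    simp
  | succ d ih =>
    obtain ⟨Z, hZ, hZc⟩ := ih
    refine ⟨(N ×ˢ Z).image fun x => x.1 ∪ x.2, ?_, ?_⟩
    · intro F A hA
      cases hA with
      | empty =>
        exact Finset.mem_image.mpr ⟨(∅, ∅), Finset.mem_product.mpr
          ⟨Finset.mem_insert_self _ _, hZ ∅ _ (Conf.empty _ _)⟩, by simp⟩
      | move _ _ m A hm hmF hA =>
        exact Finset.mem_image.mpr ⟨(m, A), Finset.mem_product.mpr ⟨hmem m hm, hZ _ _ hA⟩, rfl⟩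
    · refine Finset.card_image_le.trans ?_
      rw [Finset.card_product, pow_succ, mul_comm]
      exact Nat.mul_le_mul hZc hNc

end Scale

end JuntaCorrection

namespace JuntaCorrection

/-! ### Averages and probabilities on finite types. -/

open scoped BigOperators

section Expect

lemma expect_fin_succ {I : Type*} [Fintype I] (n : ℕ) (f : (Fin (n + 1) → I) → ℝ) :
    𝔼 ω, f ω = 𝔼 i : I, 𝔼 ω : Fin n → I, f (Fin.cons i ω) := by
  rw [← Finset.expect_product', Finset.univ_product_univ]
  exact (Fintype.expect_equiv (Fin.consEquiv fun _ => I) _ _ fun x => rfl).symm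

lemma expect_prod {I J : Type*} [Fintype I] [Fintype J] (f : I × J → ℝ) :
    𝔼 x, f x = 𝔼 i, 𝔼 j, f (i, j) := by
  rw [← Finset.univ_product_univ, Finset.expect_product]

/-- The variance of an empirical mean. -/
lemma expect_sq_empirical_mean_sub_le {X : Type*} [Fintype X] [Nonempty X] (g : X → ℝ) (m : ℝ)
    (hm : 𝔼 x, g x = m) (h0 : ∀ x, |g x - m| ≤ 1) {k : ℕ} (hk : 0 < k) :
    𝔼 ω : Fin k → X, (𝔼 j, g (ω j) - m) ^ 2 ≤ 1 / k := by
  have key : ∀ n : ℕ, 𝔼 ω : Fin n → X, (∑ j, (g (ω j) - m)) ^ 2 ≤ n := by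
    intro n
    induction n with
    | zero => simp
    | succ n ih =>
      rw [expect_fin_succ]
      have hu : 𝔼 x, (g x - m) = 0 := by
        rw [Finset.expect_sub_distrib, hm, Fintype.expect_const, sub_self]
      have h1 : ∀ (i : X) (ω : Fin n → X),
          (∑ j, (g ((Fin.cons i ω : Fin (n + 1) → X) j) - m)) ^ 2
            = (g i - m) ^ 2 + 2 * ((g i - m) * ∑ j, (g (ω j) - m)) + (∑ j, (g (ω j) - m)) ^ 2 := by
        intro i ω
        rw [Fin.sum_univ_succ]
        simp only [Fin.cons_zero, Fin.cons_succ]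
        ring
      simp only [h1, Finset.expect_add_distrib, Fintype.expect_const, ← Finset.mul_expect,
        ← Finset.expect_mul, hu]
      have h2 : 𝔼 i, (g i - m) ^ 2 ≤ 1 :=
        Finset.expect_le Finset.univ_nonempty fun x _ => (sq_le_one_iff_abs_le_one _).mpr (h0 x)
      push_cast
      linarith
  have hk' : (0 : ℝ) < k := by exact_mod_cast hk
  have h3 : ∀ ω : Fin k → X, (𝔼 j, g (ω j) - m) ^ 2
      = (∑ j, (g (ω j) - m)) ^ 2 * (1 / (k : ℝ) ^ 2) := by
    intro ω
    rw [Fintype.expect_eq_sum_div_card, Finset.sum_sub_distrib]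
    simp
    field_simp
  simp only [h3, ← Finset.expect_mul]
  calc _ ≤ (k : ℝ) * (1 / (k : ℝ) ^ 2) := by gcongr; exact key k
    _ = 1 / k := by field_simp

open Classical in
/-- The probability of an event under the uniform distribution on a finite type. -/
noncomputable def pr {Ω : Type*} [Fintype Ω] (p : Ω → Prop) : ℝ := 𝔼 ω, if p ω then 1 else 0

lemma pr_nonneg {Ω : Type*} [Fintype Ω] (p : Ω → Prop) : 0 ≤ pr p :=
  Finset.expect_nonneg fun _ _ => by split_ifs <;> norm_num

lemma pr_le_one {Ω : Type*} [Fintype Ω] [Nonempty Ω] (p : Ω → Prop) : pr p ≤ 1 :=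
  Finset.expect_le Finset.univ_nonempty fun _ _ => by split_ifs <;> norm_num

lemma pr_mono {Ω : Type*} [Fintype Ω] {p q : Ω → Prop} (h : ∀ ω, p ω → q ω) : pr p ≤ pr q := by
  refine Finset.expect_le_expect fun ω _ => ?_
  by_cases h1 : p ω
  · simp [h1, h ω h1]
  · by_cases h2 : q ω <;> simp [h1, h2]

lemma pr_or_le {Ω : Type*} [Fintype Ω] (p q : Ω → Prop) : pr (fun ω => p ω ∨ q ω) ≤ pr p + pr q := by
  rw [pr, pr, pr, ← Finset.expect_add_distrib]
  refine Finset.expect_le_expect fun ω _ => ?_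
  by_cases h1 : p ω <;> by_cases h2 : q ω <;> simp [h1, h2]

lemma pr_exists_le {Ω κ : Type*} [Fintype Ω] (s : Finset κ) (p : κ → Ω → Prop) :
    pr (fun ω => ∃ c ∈ s, p c ω) ≤ ∑ c ∈ s, pr (p c) := by
  classical
  simp only [pr]
  rw [← Finset.expect_sum_comm]
  refine Finset.expect_le_expect fun ω _ => ?_
  split_ifs with h
  · obtain ⟨c, hc, hp⟩ := h
    have := Finset.single_le_sum (f := fun c => if p c ω then (1 : ℝ) else 0)
      (fun _ _ => by split_ifs <;> norm_num) hc
    simpa [hp] using this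
  · exact Finset.sum_nonneg fun _ _ => by split_ifs <;> norm_num

/-- Markov's inequality. -/
lemma pr_mul_le {Ω : Type*} [Fintype Ω] {p : Ω → Prop} {f : Ω → ℝ} (hf : ∀ ω, 0 ≤ f ω) {a : ℝ}
    (h : ∀ ω, p ω → a ≤ f ω) : pr p * a ≤ 𝔼 ω, f ω := by
  rw [pr, Finset.expect_mul]
  refine Finset.expect_le_expect fun ω _ => ?_
  split_ifs with hp
  · simpa using h ω hp
  · simpa using hf ω

lemma pr_prod {I J : Type*} [Fintype I] [Fintype J] (p : I × J → Prop) :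
    pr p = 𝔼 i, pr fun j => p (i, j) := expect_prod _

lemma pr_comp_equiv {I J : Type*} [Fintype I] [Fintype J] (e : I ≃ J) (p : J → Prop) :
    pr (fun i => p (e i)) = pr p := Fintype.expect_equiv e _ _ fun _ => rfl

lemma pr_eq_card_div {Ω : Type*} [Fintype Ω] (p : Ω → Prop) :
    pr p = (Nat.card {ω // p ω} : ℝ) / Fintype.card Ω := by
  classical
  rw [pr, Fintype.expect_eq_sum_div_card, Finset.sum_boole, Nat.card_eq_fintype_card,
    Fintype.card_subtype]

end Expect

/-! ### Small-set expansion through a two-function hypercontractive inequality. -/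

section SmallSetExpansion

/-- The correlation that is allowed on an alphabet of size `s` for exponent `1 + γ`. -/
noncomputable def slack (s γ : ℝ) : ℝ := (s ^ γ - 1) / (s - 1)

lemma slack_pos {s γ : ℝ} (hs : 1 < s) (hγ : 0 < γ) : 0 < slack s γ :=
  div_pos (sub_pos.mpr (Real.one_lt_rpow hs hγ)) (sub_pos.mpr hs)

lemma slack_le_one {s γ : ℝ} (hs : 1 < s) (hγ : γ ≤ 1) : slack s γ ≤ 1 := by
  rw [slack, div_le_one (sub_pos.mpr hs)]
  have := Real.rpow_le_rpow_of_exponent_le hs.le hγ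
  rw [Real.rpow_one] at this
  linarith

/-- The slack is the slope of the chord of w ↦ w^γ between 1 and s. By concavity the power lies
above that line on [1, s] and below it on [0, 1], which gives the sign of the derivative of the
difference of the two sides; the minimum is 0, at v = 1. -/
lemma quadratic_le_rpow {s γ : ℝ} (hs : 1 < s) (hγ : 0 < γ) (hγ1 : γ ≤ 1) {v : ℝ} (hv : 0 ≤ v)
    (hvs : v ≤ s) :
    1 + (1 + γ) * (v - 1) + (1 + γ) / 2 * slack s γ * (v - 1) ^ 2 ≤ v ^ (1 + γ) := by
  set μ := slack s γ with hμ
  have hμs : μ * (s - 1) = s ^ γ - 1 := div_mul_cancel₀ _ (sub_pos.mpr hs).ne'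
  have hconc := Real.concaveOn_rpow hγ.le hγ1
  have hup : ∀ w, 1 ≤ w → w ≤ s → 0 ≤ w ^ γ - 1 - μ * (w - 1) := by
    intro w h1 h2
    have hb : 0 ≤ (w - 1) / (s - 1) := div_nonneg (by linarith) (by linarith)
    have ha : 0 ≤ (s - w) / (s - 1) := div_nonneg (by linarith) (by linarith)
    have hs1 : s - 1 ≠ 0 := (sub_pos.mpr hs).ne'
    have := hconc.2 (x := 1) (y := s) (by simp) (by simp; linarith) ha hb
      (by field_simp; ring)
    simp only [smul_eq_mul, Real.one_rpow] at this
    have e1 : (s - w) / (s - 1) * 1 + (w - 1) / (s - 1) * s = w := by field_simp; ring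
    rw [e1] at this
    have e2 : (s - w) / (s - 1) * 1 + (w - 1) / (s - 1) * s ^ γ = 1 + μ * (w - 1) := by
      have : s ^ γ = 1 + μ * (s - 1) := by linarith
      rw [this]; field_simp; ring
    linarith
  have hdown : ∀ w, 0 ≤ w → w ≤ 1 → w ^ γ - 1 - μ * (w - 1) ≤ 0 := by
    intro w h1 h2
    rcases h2.eq_or_lt with rfl | h2
    · simp
    have hsw : 0 < s - w := by linarith
    have hb : 0 ≤ (1 - w) / (s - w) := div_nonneg (by linarith) (by linarith)
    have ha : 0 < (s - 1) / (s - w) := div_pos (by linarith) (by linarith)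
    have := hconc.2 (x := w) (y := s) (by simpa using h1) (by simp; linarith) ha.le hb
      (by field_simp; ring)
    have e1 : (s - 1) / (s - w) * w + (1 - w) / (s - w) * s = 1 := by field_simp; ring
    simp only [smul_eq_mul] at this
    rw [e1, Real.one_rpow] at this
    have e2 : s ^ γ = 1 + μ * (s - 1) := by linarith
    rw [e2] at this
    by_contra! hcon
    have : (s - 1) / (s - w) * (1 + μ * (w - 1)) + (1 - w) / (s - w) * (1 + μ * (s - 1)) = 1 := by
      field_simp; ring
    have h5 := mul_lt_mul_of_pos_left (by linarith : 1 + μ * (w - 1) < w ^ γ) ha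
    linarith
  set φ : ℝ → ℝ := fun v =>
    v ^ (1 + γ) - (1 + (1 + γ) * (v - 1) + (1 + γ) / 2 * μ * (v - 1) ^ 2) with hφ
  have hder : ∀ w, HasDerivAt φ ((1 + γ) * (w ^ γ - 1 - μ * (w - 1))) w := by
    intro w
    have h1 := Real.hasDerivAt_rpow_const (x := w) (p := 1 + γ) (Or.inr (by linarith))
    have h2 : HasDerivAt (fun v : ℝ => v - 1) 1 w := (hasDerivAt_id w).sub_const 1
    have h3 := ((h2.const_mul (1 + γ)).const_add 1).add ((h2.pow 2).const_mul ((1 + γ) / 2 * μ))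
    refine HasDerivAt.congr_deriv (f := φ) (h1.sub h3) ?_
    simp only [add_sub_cancel_left, Nat.cast_ofNat]
    ring
  have hφ1 : φ 1 = 0 := by simp [hφ]
  have hcont : Continuous φ := continuous_iff_continuousAt.mpr fun w => (hder w).continuousAt
  have hres : 0 ≤ φ v := by
    rcases le_total 1 v with h | h
    · have hmono : MonotoneOn φ (Set.Icc 1 s) := by
        refine monotoneOn_of_deriv_nonneg (convex_Icc _ _) hcont.continuousOn
          (fun w _ => (hder w).differentiableAt.differentiableWithinAt) fun w hw => ?_
        rw [interior_Icc] at hw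
        rw [(hder w).deriv]
        exact mul_nonneg (by linarith) (hup w hw.1.le hw.2.le)
      rw [← hφ1]
      exact hmono ⟨le_rfl, hs.le⟩ ⟨h, hvs⟩ h
    · have hanti : AntitoneOn φ (Set.Icc 0 1) := by
        refine antitoneOn_of_deriv_nonpos (convex_Icc _ _) hcont.continuousOn
          (fun w _ => (hder w).differentiableAt.differentiableWithinAt) fun w hw => ?_
        rw [interior_Icc] at hw
        rw [(hder w).deriv]
        exact mul_nonpos_of_nonneg_of_nonpos (by linarith) (hdown w hw.1.le hw.2.le)
      rw [← hφ1]
      exact hanti ⟨hv, h⟩ ⟨zero_le_one, le_rfl⟩ h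
  simp only [hφ] at hres
  linarith

/-- The normalized `L^p` norm of a nonnegative function. -/
noncomputable def lpMean {X : Type*} [Fintype X] (p : ℝ) (F : X → ℝ) : ℝ :=
  (𝔼 x, F x ^ p) ^ (1 / p)

lemma lpMean_nonneg {X : Type*} [Fintype X] (p : ℝ) {F : X → ℝ} (hF : ∀ x, 0 ≤ F x) :
    0 ≤ lpMean p F :=
  Real.rpow_nonneg (Finset.expect_nonneg fun x _ => Real.rpow_nonneg (hF x) p) _

lemma lpMean_rpow {X : Type*} [Fintype X] {p : ℝ} (hp : 0 < p) {F : X → ℝ} (hF : ∀ x, 0 ≤ F x) :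
    lpMean p F ^ p = 𝔼 x, F x ^ p := by
  rw [lpMean, ← Real.rpow_mul (Finset.expect_nonneg fun x _ => Real.rpow_nonneg (hF x) p),
    one_div_mul_cancel hp.ne', Real.rpow_one]

/-- After scaling to mean one, all values lie in [0, s], so `quadratic_le_rpow` can be averaged;
Bernoulli's inequality with exponent 2 / (1 + γ) ≥ 1 then passes to the squared norm. -/
lemma mean_sq_le_lpMean_sq {S : Type*} [Fintype S] (hS : 2 ≤ Fintype.card S) {γ : ℝ} (hγ : 0 < γ)
    (hγ1 : γ ≤ 1) {F : S → ℝ} (hF : ∀ x, 0 ≤ F x) :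
    (1 - slack (Fintype.card S) γ) * (𝔼 x, F x) ^ 2 + slack (Fintype.card S) γ * 𝔼 x, F x ^ 2
      ≤ lpMean (1 + γ) F ^ 2 := by
  have : Nonempty S := Fintype.card_pos_iff.mp (by omega)
  set s : ℝ := ((Fintype.card S : ℕ) : ℝ) with hs
  have hs1 : 1 < s := by rw [hs]; exact_mod_cast hS
  set μ := slack s γ
  set a := 𝔼 x, F x with ha
  have ha0 : 0 ≤ a := Finset.expect_nonneg fun x _ => hF x
  rcases ha0.eq_or_lt with h0 | hapos
  · have hF0 : F = 0 := (Fintype.expect_eq_zero_iff_of_nonneg (f := F) hF).mp h0.symm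
    rw [← h0, hF0]
    simp only [Pi.zero_apply, ne_eq, OfNat.ofNat_ne_zero, not_false_eq_true, zero_pow, mul_zero,
      Finset.expect_const_zero, add_zero]
    positivity
  have hp : 0 < 1 + γ := by linarith
  have hFs : ∀ x, F x / a ≤ s := by
    intro x
    rw [div_le_iff₀ hapos, ha, hs, Fintype.card_mul_expect]
    exact Finset.single_le_sum (fun y _ => hF y) (Finset.mem_univ x)
  have hv : ∀ x, 0 ≤ F x / a := fun x => div_nonneg (hF x) ha0
  have hv1 : 𝔼 x, F x / a = 1 := by rw [← Finset.expect_div, ← ha, div_self hapos.ne']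
  set X := μ * (𝔼 x, (F x / a) ^ 2 - 1) with hX
  have hvar : 𝔼 x, (F x / a - 1) ^ 2 = 𝔼 x, (F x / a) ^ 2 - 1 := by
    have : ∀ x, (F x / a - 1) ^ 2 = (F x / a) ^ 2 - 2 * (F x / a) + 1 := fun x => by ring
    simp only [this, Finset.expect_add_distrib, Finset.expect_sub_distrib, ← Finset.mul_expect,
      hv1, Fintype.expect_const]
    ring
  have hX0 : 0 ≤ X := by
    rw [hX, ← hvar]
    exact mul_nonneg (slack_pos hs1 hγ).le (Finset.expect_nonneg fun x _ => sq_nonneg _)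
  have h1 : 1 + (1 + γ) / 2 * X ≤ 𝔼 x, (F x / a) ^ (1 + γ) := by
    have := Finset.expect_le_expect (s := Finset.univ) fun x (_ : x ∈ Finset.univ) =>
      quadratic_le_rpow hs1 hγ hγ1 (hv x) (hFs x)
    simp only [Finset.expect_add_distrib, Finset.expect_sub_distrib, ← Finset.mul_expect,
      hv1, Fintype.expect_const, hvar] at this
    rw [hX]
    linarith
  have h2 : 1 + X ≤ (𝔼 x, (F x / a) ^ (1 + γ)) ^ (2 / (1 + γ)) := by
    have hb := one_add_mul_self_le_rpow_one_add (s := (1 + γ) / 2 * X) (p := 2 / (1 + γ))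
      (by have : 0 ≤ (1 + γ) / 2 * X := by positivity
          linarith) (by rw [le_div_iff₀ hp]; linarith)
    calc 1 + X = 1 + 2 / (1 + γ) * ((1 + γ) / 2 * X) := by field_simp
      _ ≤ _ := hb
      _ ≤ _ := Real.rpow_le_rpow (by positivity) h1 (by positivity)
  have h3 : lpMean (1 + γ) F ^ 2 = a ^ 2 * (𝔼 x, (F x / a) ^ (1 + γ)) ^ (2 / (1 + γ)) := by
    have e : 𝔼 x, F x ^ (1 + γ) = a ^ (1 + γ) * 𝔼 x, (F x / a) ^ (1 + γ) := by
      rw [Finset.mul_expect]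
      refine Finset.expect_congr rfl fun x _ => ?_
      rw [← Real.mul_rpow ha0 (hv x), mul_div_cancel₀ _ hapos.ne']
    have hn : 0 ≤ 𝔼 x, (F x / a) ^ (1 + γ) :=
      Finset.expect_nonneg fun x _ => Real.rpow_nonneg (hv x) _
    rw [lpMean, ← Real.rpow_natCast, ← Real.rpow_mul
      (Finset.expect_nonneg fun x _ => Real.rpow_nonneg (hF x) _), e,
      Real.mul_rpow (by positivity) hn, ← Real.rpow_mul ha0]
    have e1 : (1 + γ) * (1 / (1 + γ) * ((2 : ℕ) : ℝ)) = ((2 : ℕ) : ℝ) := by field_simp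
    have e2 : 1 / (1 + γ) * ((2 : ℕ) : ℝ) = 2 / (1 + γ) := by push_cast; ring
    rw [e1, e2, Real.rpow_natCast]
  rw [h3]
  calc (1 - μ) * a ^ 2 + μ * 𝔼 x, F x ^ 2 = a ^ 2 * (1 + X) := by
        rw [hX]
        have : 𝔼 x, (F x / a) ^ 2 = (𝔼 x, F x ^ 2) / a ^ 2 := by
          rw [Finset.expect_div]
          exact Finset.expect_congr rfl fun x _ => by rw [div_pow]
        rw [this]
        field_simp
        ring
    _ ≤ _ := by gcongr

/-- The frequency of a value in a finite word. -/
noncomputable def freq {S : Type*} {k : ℕ} (z : Fin k → S) (c : S) : ℝ := pr fun j => z j = c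

lemma expect_comp_eq_sum_freq {S : Type*} [Fintype S] {k : ℕ} (z : Fin k → S) (R : S → ℝ) :
    𝔼 j, R (z j) = ∑ c, freq z c * R c := by
  classical
  have : ∀ j, R (z j) = ∑ c, (if z j = c then (1 : ℝ) else 0) * R c := by
    intro j; simp
  simp only [this]
  rw [Finset.expect_sum_comm]
  refine Finset.sum_congr rfl fun c _ => ?_
  rw [← Finset.expect_mul, freq, pr]

/-- The frequencies split into a uniform part of mass 1 - μ, which contributes the product of the
means, and a nonnegative remainder of mass μ, bounded by Cauchy–Schwarz through the L² norms.
`mean_sq_le_lpMean_sq` absorbs both. -/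
lemma expect_mul_le_lpMean_mul_lpMean {S : Type*} [Fintype S] [AddCommGroup S]
    (hS : 2 ≤ Fintype.card S)
    {γ : ℝ} (hγ : 0 < γ) (hγ1 : γ ≤ 1) {k : ℕ} (hk : 0 < k) {z z' : Fin k → S}
    (hz : ∀ c, (1 - slack (Fintype.card S) γ) / Fintype.card S ≤ freq (z - z') c)
    {F K : S → ℝ} (hF : ∀ x, 0 ≤ F x) (hK : ∀ x, 0 ≤ K x) :
    𝔼 i : Fin k × S, F (i.2 + z i.1) * K (i.2 + z' i.1) ≤ lpMean (1 + γ) F * lpMean (1 + γ) K := by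
  have : Nonempty S := ⟨0⟩
  have : Nonempty (Fin k) := ⟨⟨0, hk⟩⟩
  set s : ℝ := ((Fintype.card S : ℕ) : ℝ) with hs
  have hs1 : 1 < s := by rw [hs]; exact_mod_cast hS
  set μ := slack s γ with hμ
  have hμ0 := slack_pos hs1 hγ
  have hμ1 := slack_le_one hs1 hγ1
  set R : S → ℝ := fun c => 𝔼 x, F (x + c) * K x with hR
  have hR0 : ∀ c, 0 ≤ R c := fun c => Finset.expect_nonneg fun x _ => mul_nonneg (hF _) (hK _)
  have h1 : 𝔼 i : Fin k × S, F (i.2 + z i.1) * K (i.2 + z' i.1) = ∑ c, freq (z - z') c * R c := by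
    rw [expect_prod, ← expect_comp_eq_sum_freq]
    refine Finset.expect_congr rfl fun j _ => ?_
    refine Fintype.expect_equiv (Equiv.addRight (z' j)) _ _ fun x => ?_
    simp
  have hsum : ∑ c, freq (z - z') c = 1 := by
    have := expect_comp_eq_sum_freq (z - z') fun _ => (1 : ℝ)
    simpa [Fintype.expect_const] using this.symm
  set A := Real.sqrt (𝔼 x, F x ^ 2)
  set B := Real.sqrt (𝔼 x, K x ^ 2)
  have hF2 : 0 ≤ 𝔼 x, F x ^ 2 := Finset.expect_nonneg fun x _ => sq_nonneg _
  have hK2 : 0 ≤ 𝔼 x, K x ^ 2 := Finset.expect_nonneg fun x _ => sq_nonneg _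
  have hRle : ∀ c, R c ≤ A * B := by
    intro c
    refine (Real.le_sqrt_of_sq_le (y := (𝔼 x, F x ^ 2) * 𝔼 x, K x ^ 2) ?_).trans_eq
      (Real.sqrt_mul hF2 _)
    have := Finset.expect_mul_sq_le_sq_mul_sq Finset.univ (fun x => F (x + c)) K
    rwa [Fintype.expect_equiv (Equiv.addRight c) (fun x => F (x + c) ^ 2) (fun x => F x ^ 2)
      fun x => rfl] at this
  have hRsum : ∑ c, R c = s * ((𝔼 x, F x) * 𝔼 x, K x) := by
    rw [hs, ← Fintype.card_mul_expect]
    congr 1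
    simp only [hR]
    rw [Finset.expect_comm]
    rw [Finset.mul_expect]
    refine Finset.expect_congr rfl fun x _ => ?_
    rw [← Finset.expect_mul]
    congr 1
    exact Fintype.expect_equiv (Equiv.addLeft x) _ _ fun c => rfl
  have h2 : ∑ c, freq (z - z') c * R c
      ≤ (1 - μ) * ((𝔼 x, F x) * 𝔼 x, K x) + μ * (A * B) := by
    have e : ∀ c, freq (z - z') c * R c
        = (freq (z - z') c - (1 - μ) / s) * R c + (1 - μ) / s * R c := fun c => by ring
    simp only [e, Finset.sum_add_distrib, ← Finset.mul_sum, hRsum]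
    have h3 : ∑ c, (freq (z - z') c - (1 - μ) / s) * R c
        ≤ ∑ c, (freq (z - z') c - (1 - μ) / s) * (A * B) :=
      Finset.sum_le_sum fun c _ => mul_le_mul_of_nonneg_left (hRle c) (sub_nonneg.mpr (hz c))
    rw [← Finset.sum_mul, Finset.sum_sub_distrib, hsum, Finset.sum_const, Finset.card_univ,
      nsmul_eq_mul, ← hs] at h3
    have e2 : s * ((1 - μ) / s) = 1 - μ := by field_simp
    have e3 : (1 - μ) / s * (s * ((𝔼 x, F x) * 𝔼 x, K x)) = (1 - μ) * ((𝔼 x, F x) * 𝔼 x, K x) := by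
      field_simp
    rw [e2] at h3
    rw [e3]
    linarith
  rw [h1]
  refine h2.trans (le_of_sq_le_sq ?_ (mul_nonneg (lpMean_nonneg _ hF) (lpMean_nonneg _ hK)))
  have hf := mean_sq_le_lpMean_sq hS hγ hγ1 hF
  have hg := mean_sq_le_lpMean_sq hS hγ hγ1 hK
  rw [← hs, ← hμ] at hf hg
  have hA : A ^ 2 = 𝔼 x, F x ^ 2 := Real.sq_sqrt hF2
  have hB : B ^ 2 = 𝔼 x, K x ^ 2 := Real.sq_sqrt hK2
  rw [← hA] at hf
  rw [← hB] at hg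
  have hl : 0 ≤ 1 - μ := by linarith
  rw [mul_pow]
  refine le_trans ?_ (mul_le_mul hf hg (by positivity) (by positivity))
  nlinarith [mul_nonneg (mul_nonneg hl hμ0.le) (sq_nonneg ((𝔼 x, F x) * B - (𝔼 x, K x) * A))]

/-- Tensorization of a two-function inequality. -/
lemma expect_mul_le_lpMean_mul_lpMean_pi {S I : Type*} [Fintype S] [Fintype I] {p : ℝ} (hp : 0 < p)
    (α β : I → S)
    (H : ∀ F K : S → ℝ, (∀ x, 0 ≤ F x) → (∀ x, 0 ≤ K x) →
      𝔼 i, F (α i) * K (β i) ≤ lpMean p F * lpMean p K) (n : ℕ) {F K : (Fin n → S) → ℝ}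
    (hF : ∀ x, 0 ≤ F x) (hK : ∀ x, 0 ≤ K x) :
    𝔼 ω : Fin n → I, F (α ∘ ω) * K (β ∘ ω) ≤ lpMean p F * lpMean p K := by
  induction n with
  | zero =>
    have h : ∀ F : (Fin 0 → S) → ℝ, (∀ x, 0 ≤ F x) → lpMean p F = F default := by
      intro F hF
      simp only [lpMean, Finset.univ_unique, Finset.expect_singleton]
      rw [← Real.rpow_mul (hF _), mul_one_div_cancel hp.ne', Real.rpow_one]
    rw [h F hF, h K hK]
    simp only [Finset.univ_unique, Finset.expect_singleton]
    rw [Subsingleton.elim (α ∘ default) default, Subsingleton.elim (β ∘ default) default]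
  | succ n ih =>
    -- The norm on a product is an iterated norm, so the one-letter inequality applies to the norms
    -- of the slices.
    have hlp : ∀ {F : (Fin (n + 1) → S) → ℝ}, (∀ x, 0 ≤ F x) →
        lpMean p F = lpMean p fun a : S => lpMean p fun w : Fin n → S => F (Fin.cons a w) := by
      intro F hF
      conv_rhs => rw [lpMean]
      simp only [lpMean_rpow hp fun w : Fin n → S => hF _]
      rw [lpMean, expect_fin_succ]
    rw [expect_fin_succ, hlp hF, hlp hK]
    refine le_trans ?_ (H _ _ (fun a => lpMean_nonneg _ fun w => hF _)
      fun a => lpMean_nonneg _ fun w => hK _)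
    refine Finset.expect_le_expect fun i _ => ?_
    refine le_trans (le_of_eq ?_) (ih (fun w => hF _) fun w => hK _)
    refine Finset.expect_congr rfl fun ω _ => ?_
    congr 2 <;>
    · funext j
      refine Fin.cases ?_ (fun j => ?_) j <;> simp

/-- Small-set expansion: two points `x + z ∘ h` and `x + z' ∘ h`, for uniform `x` and `h` and words
`z`, `z'` whose difference is nearly balanced, rarely belong to the same small set. -/
lemma pr_and_le_rpow {S : Type*} [Fintype S] [AddCommGroup S] (hS : 2 ≤ Fintype.card S)
    {γ : ℝ} (hγ : 0 < γ) (hγ1 : γ ≤ 1) {k : ℕ} (hk : 0 < k) {z z' : Fin k → S}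
    (hz : ∀ c, (1 - slack (Fintype.card S) γ) / Fintype.card S ≤ freq (z - z') c)
    (n : ℕ) (T : (Fin n → S) → Prop) :
    𝔼 h : Fin n → Fin k, pr (fun x => T (x + z ∘ h) ∧ T (x + z' ∘ h)) ≤ pr T ^ (2 / (1 + γ)) := by
  classical
  have hp : 0 < 1 + γ := by linarith
  have h := expect_mul_le_lpMean_mul_lpMean_pi (I := Fin k × S) hp (fun i => i.2 + z i.1)
    (fun i => i.2 + z' i.1)
    (fun F K hF hK => expect_mul_le_lpMean_mul_lpMean hS hγ hγ1 hk hz hF hK) n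
    (F := fun x => if T x then 1 else 0) (K := fun x => if T x then 1 else 0)
    (fun x => by split_ifs <;> norm_num) (fun x => by split_ifs <;> norm_num)
  have hl : lpMean (1 + γ) (fun x => if T x then (1 : ℝ) else 0) = pr T ^ (1 / (1 + γ)) := by
    rw [lpMean, pr]
    congr 1
    refine Finset.expect_congr rfl fun x _ => ?_
    split_ifs
    · simp
    · rw [Real.zero_rpow hp.ne']
  rw [hl, ← Real.rpow_add_of_nonneg (pr_nonneg T) (by positivity) (by positivity), ← add_div,
    one_add_one_eq_two] at h
  refine le_trans (le_of_eq ?_) h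
  refine (pr_prod fun y : (Fin n → Fin k) × (Fin n → S) =>
    T (y.2 + z ∘ y.1) ∧ T (y.2 + z' ∘ y.1)).symm.trans ?_
  rw [pr]
  refine (Fintype.expect_equiv (Equiv.arrowProdEquivProdArrow (Fin n) (fun _ => Fin k)
    (fun _ => S)) _ _ fun ω => ?_).symm
  have e1 : ∀ z : Fin k → S, (fun i : Fin k × S => i.2 + z i.1) ∘ ω =
    ((Equiv.arrowProdEquivProdArrow (Fin n) (fun _ => Fin k) (fun _ => S)) ω).2 +
      z ∘ ((Equiv.arrowProdEquivProdArrow (Fin n) (fun _ => Fin k) (fun _ => S)) ω).1 :=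
    fun z => rfl
  rw [e1, e1]
  generalize T _ = p
  generalize T _ = q
  by_cases hp : p <;> by_cases hq : q <;> simp [hp, hq]

/-- For long words almost all pairs have a nearly balanced difference. -/
lemma pr_unbalanced_le {S : Type*} [Fintype S] [AddCommGroup S]
    {μ : ℝ} (hμ : 0 < μ) {k : ℕ} (hk : 0 < k) :
    𝔼 z : Fin k → S, pr (fun z' : Fin k → S =>
      ¬ ∀ c, (1 - μ) / Fintype.card S ≤ freq (z - z') c) ≤ (Fintype.card S : ℝ) ^ 3 / (k * μ ^ 2) := by
  classical
  have : Nonempty S := ⟨0⟩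
  set s : ℝ := ((Fintype.card S : ℕ) : ℝ) with hs
  have hs0 : 0 < s := by rw [hs]; exact_mod_cast Fintype.card_pos
  -- For fixed z the difference z - z' is uniform; Chebyshev for each letter and a union bound over
  -- the s letters follow.
  have h1 : ∀ z : Fin k → S, pr (fun z' : Fin k → S => ¬ ∀ c, (1 - μ) / s ≤ freq (z - z') c)
      = pr fun w : Fin k → S => ¬ ∀ c, (1 - μ) / s ≤ freq w c :=
    fun z => pr_comp_equiv (Equiv.subLeft z) fun w => ¬ ∀ c, (1 - μ) / s ≤ freq w c
  simp only [h1, Fintype.expect_const]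
  have hc : ∀ c : S, pr (fun w : Fin k → S => freq w c < (1 - μ) / s) ≤ s ^ 2 / (k * μ ^ 2) := by
    intro c
    have hm : 𝔼 x : S, (if x = c then (1 : ℝ) else 0) = 1 / s := by
      rw [Fintype.expect_eq_sum_div_card]; simp [hs]
    have hs1 : 1 / s ≤ 1 := by
      rw [div_le_one hs0, hs]; exact_mod_cast Fintype.card_pos
    have hs2 : 0 < 1 / s := by positivity
    have hV := expect_sq_empirical_mean_sub_le (fun x : S => if x = c then (1 : ℝ) else 0) (1 / s)
      hm (fun x => by split_ifs <;> rw [abs_le] <;> constructor <;> linarith) hk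
    have hM := pr_mul_le (p := fun w : Fin k → S => freq w c < (1 - μ) / s)
      (f := fun w => (𝔼 j, (if w j = c then (1 : ℝ) else 0) - 1 / s) ^ 2)
      (fun _ => sq_nonneg _) (a := (μ / s) ^ 2) ?_
    · have h3 := hM.trans hV
      have hk' : (0 : ℝ) < k := by exact_mod_cast hk
      rw [← le_div_iff₀ (by positivity)] at h3
      refine h3.trans_eq ?_
      field_simp
    · intro w hw
      have e : freq w c = 𝔼 j, (if w j = c then (1 : ℝ) else 0) := by
        rw [freq, pr]
      rw [e] at hw
      have e2 : (1 - μ) / s = 1 / s - μ / s := by ring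
      rw [← sq_abs (𝔼 j, _ - 1 / s)]
      apply pow_le_pow_left₀ (by positivity)
      rw [le_abs]
      right
      linarith
  calc _ ≤ pr (fun w : Fin k → S => ∃ c ∈ (Finset.univ : Finset S), freq w c < (1 - μ) / s) :=
        pr_mono fun w hw => by push Not at hw; simpa using hw
    _ ≤ ∑ c : S, s ^ 2 / (k * μ ^ 2) := (pr_exists_le _ _).trans (Finset.sum_le_sum fun c _ => hc c)
    _ = _ := by rw [Finset.sum_const, Finset.card_univ, nsmul_eq_mul, ← hs]; ring

end SmallSetExpansion

end JuntaCorrection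

namespace JuntaCorrection

open scoped BigOperators

/-! ### Local oracle transformations and query algorithms. -/

section Oracle

variable {D G : Type*}

/-- An oracle transformation each of whose values depends on at most `q` values of the oracle. -/
def Local (q : ℕ) (Φ : (D → G) → D → G) : Prop :=
  ∀ x, ∃ Z : Finset D, Z.card ≤ q ∧ ∀ f f' : D → G, (∀ z ∈ Z, f z = f' z) → Φ f x = Φ f' x

lemma Local.comp {q q' : ℕ} {Φ Ψ : (D → G) → D → G} (hΦ : Local q Φ) (hΨ : Local q' Ψ) :
    Local (q * q') fun f => Ψ (Φ f) := by
  classical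
  intro x
  obtain ⟨Z, hZ, h⟩ := hΨ x
  choose W hW hWf using hΦ
  refine ⟨Z.biUnion W, ?_, fun f f' hff => h _ _ fun z hz => hWf z _ _ fun w hw =>
    hff w (Finset.mem_biUnion.mpr ⟨z, hz, hw⟩)⟩
  refine (Finset.card_biUnion_le_card_mul _ _ q fun z _ => hW z).trans ?_
  rw [mul_comm]
  exact Nat.mul_le_mul_left _ hZ

lemma makesAtMost_mono {R : Type*} {T : QueryAlg D G R} {q q' : ℕ} (h : T.MakesAtMost q)
    (hq : q ≤ q') : T.MakesAtMost q' := by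
  induction T generalizing q q' with
  | output r => trivial
  | query x next ih =>
    cases q with
    | zero => exact h.elim
    | succ q =>
      obtain ⟨q', rfl⟩ := Nat.exists_eq_add_of_le' (show 1 ≤ q' by omega)
      exact fun g => ih g (h g) (by omega)

/-- The points of Z are read one after the other, each answer being written into the oracle by
`Function.update`. -/
lemma exists_queryAlg {R : Type*} [Nonempty G] (Z : Finset D) (F : (D → G) → R)
    (hF : ∀ f f' : D → G, (∀ z ∈ Z, f z = f' z) → F f = F f') :
    ∃ T : QueryAlg D G R, T.MakesAtMost Z.card ∧ ∀ f, T.eval f = F f := by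
  classical
  induction Z using Finset.induction_on generalizing F with
  | empty =>
    exact ⟨.output (F fun _ => Classical.arbitrary G), trivial, fun f => hF _ _ (by simp)⟩
  | insert a Z ha ih =>
    have key : ∀ g : G, ∃ T : QueryAlg D G R, T.MakesAtMost Z.card ∧
        ∀ f, T.eval f = F (Function.update f a g) := by
      intro g
      refine ih (fun f => F (Function.update f a g)) fun f f' hff => hF _ _ fun z hz => ?_
      by_cases hza : z = a
      · subst hza; simp
      · simp only [Function.update_of_ne hza]
        exact hff z ((Finset.mem_insert.mp hz).resolve_left hza)
    choose T hT hTe using key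
    refine ⟨.query a T, ?_, fun f => ?_⟩
    · rw [Finset.card_insert_of_notMem ha]
      exact hT
    · rw [QueryAlg.eval, hTe, Function.update_eq_self]

lemma relHammingDist_eq_pr [Fintype D] (f P : D → G) :
    relHammingDist f P = pr fun x => f x ≠ P x := by
  classical
  rw [relHammingDist, pr_eq_card_div, hammingDist, Nat.card_eq_fintype_card, Fintype.card_subtype]

lemma locallyCorrectable_of_local [Fintype D] [Nonempty G] {F : Set (D → G)} {q : ℕ} {δ : ℝ}
    {Ω : Type*} [Fintype Ω] [Nonempty Ω] (Φ : Ω → (D → G) → D → G) (hΦ : ∀ ω, Local q (Φ ω))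
    (h : ∀ f, ∀ P ∈ F, pr (fun x => f x ≠ P x) ≤ δ → ∀ x, pr (fun ω => Φ ω f x ≠ P x) ≤ 1 / 4) :
    LocallyCorrectable F q δ := by
  classical
  have key : ∀ ω x, ∃ T : QueryAlg D G G, T.MakesAtMost q ∧ ∀ f, T.eval f = Φ ω f x := by
    intro ω x
    obtain ⟨Z, hZ, hf⟩ := hΦ ω x
    obtain ⟨T, hT, hTe⟩ := exists_queryAlg Z (fun f => Φ ω f x) hf
    exact ⟨T, makesAtMost_mono hT hZ, hTe⟩
  choose T hT hTe using key
  refine ⟨fun x => (PMF.uniformOfFintype Ω).map fun ω => T ω x, ?_, ?_⟩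
  · intro x t ht
    rw [PMF.support_map] at ht
    obtain ⟨ω, -, rfl⟩ := ht
    exact hT ω x
  · intro f P hP hd x
    rw [relHammingDist_eq_pr] at hd
    have h1 := h f P hP hd x
    rw [PMF.map_comp, PMF.map_apply, tsum_fintype]
    simp only [Function.comp_apply, hTe, PMF.uniformOfFintype_apply]
    rw [← Finset.sum_filter, Finset.sum_const, nsmul_eq_mul]
    rw [pr_eq_card_div, Nat.card_eq_fintype_card, Fintype.card_subtype] at h1
    have hΩ : 0 < Fintype.card Ω := Fintype.card_pos
    rw [div_le_iff₀ (by exact_mod_cast hΩ)] at h1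
    have hsplit := Finset.card_filter_add_card_filter_not (s := (Finset.univ : Finset Ω))
      (fun ω => P x = Φ ω f x)
    rw [Finset.card_univ] at hsplit
    have hbad : (Finset.univ.filter fun ω => ¬ P x = Φ ω f x)
        = Finset.univ.filter fun ω => Φ ω f x ≠ P x := by
      ext ω; simp [eq_comm]
    rw [hbad] at hsplit
    have h2 : 4 * (Finset.univ.filter fun ω => Φ ω f x ≠ P x).card ≤ Fintype.card Ω := by
      have : (4 : ℝ) * (Finset.univ.filter fun ω => Φ ω f x ≠ P x).card ≤ Fintype.card Ω := by
        linarith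
      exact_mod_cast this
    have h3 : 3 * Fintype.card Ω ≤ (Finset.univ.filter fun ω => P x = Φ ω f x).card * 4 := by
      omega
    rw [← div_eq_mul_inv, ENNReal.div_le_iff (by norm_num) (by norm_num),
      ENNReal.mul_div_right_comm.symm, ENNReal.le_div_iff_mul_le (by simp [hΩ.ne']) (by simp)]
    exact_mod_cast h3

end Oracle

/-! ### Composing randomized reductions and correctors. -/

section Reduction

variable {S : Type u} {G : Type v} [Fintype S] [AddCommGroup G]

variable (S G) in
/-- A random `q`-local transformation that, with failure probability at most `θ`, turns every
oracle at distance at most `δ` from a function of degree at most `d` into one at distance at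
most `δ'`. -/
def Reduces (n d q : ℕ) (δ δ' θ : ℝ) : Prop :=
  ∃ (Ω : Type) (_ : Fintype Ω) (_ : Nonempty Ω) (Φ : Ω → ((Fin n → S) → G) → (Fin n → S) → G),
    (∀ ω, Local q (Φ ω)) ∧ ∀ f P, LowDeg d P → pr (fun x => f x ≠ P x) ≤ δ →
      pr (fun ω => δ' < pr fun x => Φ ω f x ≠ P x) ≤ θ

variable (S G) in
/-- A random `q`-local transformation that recovers each value of a function of degree at most `d`
from every oracle at distance at most `δ`, with failure probability at most `θ`. -/
def Corrects (n d q : ℕ) (δ θ : ℝ) : Prop :=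
  ∃ (Ω : Type u) (_ : Fintype Ω) (_ : Nonempty Ω) (Φ : Ω → ((Fin n → S) → G) → (Fin n → S) → G),
    (∀ ω, Local q (Φ ω)) ∧ ∀ f P, LowDeg d P → pr (fun x => f x ≠ P x) ≤ δ →
      ∀ x, pr (fun ω => Φ ω f x ≠ P x) ≤ θ

variable {n d q q' : ℕ} {δ δ' δ'' θ θ' : ℝ}

lemma pr_prod_le {I J : Type*} [Fintype I] [Fintype J] [Nonempty I] [Nonempty J] {p : I → Prop}
    {r : I × J → Prop} {a b : ℝ} (hp : pr p ≤ a) (hb : 0 ≤ b)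
    (hr : ∀ i, ¬ p i → pr (fun j => r (i, j)) ≤ b) : pr r ≤ a + b := by
  classical
  rw [pr_prod]
  calc _ ≤ 𝔼 i, ((if p i then 1 else 0) + b) := by
        refine Finset.expect_le_expect fun i _ => ?_
        by_cases h : p i
        · rw [if_pos h]
          linarith [pr_le_one fun j => r (i, j)]
        · rw [if_neg h, zero_add]
          exact hr i h
    _ = pr p + b := by
        rw [Finset.expect_add_distrib, Fintype.expect_const, pr]
    _ ≤ a + b := by linarith

/-- The first random choice is drawn once for the whole table, so the second stage sees a genuine
fixed oracle; queries multiply and failure probabilities add. -/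
lemma Reduces.comp (h : Reduces S G n d q δ δ' θ) (h' : Reduces S G n d q' δ' δ'' θ')
    (hθ' : 0 ≤ θ') : Reduces S G n d (q * q') δ δ'' (θ + θ') := by
  obtain ⟨Ω, _, _, Φ, hΦ, hf⟩ := h
  obtain ⟨Ω', _, _, Ψ, hΨ, hg⟩ := h'
  refine ⟨Ω × Ω', inferInstance, inferInstance, fun ω f => Ψ ω.2 (Φ ω.1 f),
    fun ω => (hΦ ω.1).comp (hΨ ω.2), fun f P hP hd => ?_⟩
  exact pr_prod_le (r := fun ω : Ω × Ω' => δ'' < pr fun x => Ψ ω.2 (Φ ω.1 f) x ≠ P x)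
    (hf f P hP hd) hθ' fun ω hω => hg (Φ ω f) P hP (not_lt.mp hω)

lemma Reduces.corrects (h : Reduces S G n d q δ δ' θ) (h' : Corrects S G n d q' δ' θ')
    (hθ' : 0 ≤ θ') : Corrects S G n d (q * q') δ (θ + θ') := by
  obtain ⟨Ω, _, _, Φ, hΦ, hf⟩ := h
  obtain ⟨Ω', _, _, Ψ, hΨ, hg⟩ := h'
  refine ⟨Ω × Ω', inferInstance, inferInstance, fun ω f => Ψ ω.2 (Φ ω.1 f),
    fun ω => (hΦ ω.1).comp (hΨ ω.2), fun f P hP hd x => ?_⟩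
  exact pr_prod_le (r := fun ω : Ω × Ω' => Ψ ω.2 (Φ ω.1 f) x ≠ P x)
    (hf f P hP hd) hθ' fun ω hω => hg (Φ ω f) P hP (not_lt.mp hω) x

lemma Reduces.mono (h : Reduces S G n d q δ δ' θ) (hθ : θ ≤ θ') (hδ : δ' ≤ δ'') :
    Reduces S G n d q δ δ'' θ' := by
  obtain ⟨Ω, i, j, Φ, hΦ, hf⟩ := h
  exact ⟨Ω, i, j, Φ, hΦ, fun f P hP hd =>
    ((pr_mono fun ω hω => hδ.trans_lt hω).trans (hf f P hP hd)).trans hθ⟩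

lemma Reduces.refl (hθ : 0 ≤ θ) : Reduces S G n d 1 δ δ θ := by
  refine ⟨Unit, inferInstance, inferInstance, fun _ f => f, fun _ x => ⟨{x}, by simp, by simp⟩, ?_⟩
  intro f P _ hd
  refine le_trans (le_of_eq ?_) hθ
  rw [pr]
  exact Finset.expect_eq_zero fun _ _ => if_neg (not_lt.mpr hd)

lemma Corrects.locallyCorrectable (h : Corrects S G n d q δ (1 / 4)) :
    LocallyCorrectable (juntaSums S G n d) q δ := by
  obtain ⟨Ω, _, _, Φ, hΦ, hf⟩ := h
  exact locallyCorrectable_of_local Φ hΦ fun f P hP hd x =>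
    hf f P (lowDeg_of_mem_juntaSums hP) hd x

end Reduction

/-! ### Degree zero. -/

section Constant

/-- Constant functions are corrected by a majority vote. -/
lemma corrects_zero {S : Type u} {G : Type v} [Fintype S] [Nonempty S] [AddCommGroup G] (n : ℕ)
    {ε : ℝ} (hε : 0 < ε)
    {m : ℕ} (hm : 0 < m) (hmε : 4 ≤ m * ε ^ 2) : Corrects S G n 0 m (1 / 2 - ε) (1 / 4) := by
  classical
  have : Nonempty (Fin m) := ⟨⟨0, hm⟩⟩
  -- The strict bound 1 / 2 makes the majority value unique; the default 0 plays no role.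
  let dec : (Fin m → G) → G := fun g => if h : ∃ v, pr (fun j => g j ≠ v) < 1 / 2 then h.choose else 0
  have hdec : ∀ g v, pr (fun j => g j ≠ v) < 1 / 2 → dec g = v := by
    intro g v hv
    have h : ∃ v, pr (fun j => g j ≠ v) < 1 / 2 := ⟨v, hv⟩
    simp only [dec, dif_pos h]
    by_contra hne
    have h1 := pr_or_le (fun j => g j ≠ v) (fun j => g j ≠ h.choose)
    have h2 : pr (fun j => g j ≠ v ∨ g j ≠ h.choose) = 1 := by
      rw [pr]
      rw [Finset.expect_congr rfl (g := fun _ => (1 : ℝ)), Fintype.expect_const]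
      intro j _
      rw [if_pos]
      by_contra! hcon
      exact hne (hcon.2.symm.trans hcon.1)
    linarith [h.choose_spec]
  refine ⟨Fin m → (Fin n → S), inferInstance, inferInstance, fun ω f _ => dec fun j => f (ω j),
    fun ω x => ⟨Finset.univ.image ω, ?_, fun f f' hff => ?_⟩, fun f P hP hd x => ?_⟩
  · exact Finset.card_image_le.trans (by simp)
  · simp only
    congr 1
    funext j
    exact hff _ (by simp)
  · set τ := pr (fun y => f y ≠ P y) with hτ
    have hτ0 : 0 ≤ τ := pr_nonneg _
    have hτ1 : τ ≤ 1 := pr_le_one _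
    have hV := expect_sq_empirical_mean_sub_le (fun y => if f y ≠ P y then (1 : ℝ) else 0) τ
      (by rw [hτ, pr]; congr!) (fun y => by split_ifs <;> rw [abs_le] <;> constructor <;> linarith)
      hm
    have hM := pr_mul_le (p := fun ω : Fin m → (Fin n → S) => (dec fun j => f (ω j)) ≠ P x)
      (f := fun ω => (𝔼 j, (if f (ω j) ≠ P (ω j) then (1 : ℝ) else 0) - τ) ^ 2)
      (fun _ => sq_nonneg _) (a := ε ^ 2) ?_
    · have hm' : (0 : ℝ) < m := by exact_mod_cast hm
      have h3 := hM.trans hV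
      rw [← le_div_iff₀ (by positivity)] at h3
      refine h3.trans ?_
      rw [div_div, div_le_div_iff₀ (by positivity) (by norm_num)]
      linarith
    · intro ω hω
      have h4 : 1 / 2 ≤ pr fun j => f (ω j) ≠ P (ω j) := by
        by_contra! hcon
        refine hω (hdec _ _ ?_)
        have e : (fun j => f (ω j) ≠ P x) = fun j => f (ω j) ≠ P (ω j) :=
          funext fun j => by rw [hP x (ω j)]
        rwa [e]
      have h5 : ε ≤ 𝔼 j, (if f (ω j) ≠ P (ω j) then (1 : ℝ) else 0) - τ := by
        have : pr (fun j => f (ω j) ≠ P (ω j))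
            = 𝔼 j, (if f (ω j) ≠ P (ω j) then (1 : ℝ) else 0) := by rw [pr]; congr!
        linarith
      exact pow_le_pow_left₀ hε.le h5 2

end Constant

/-! ### Decoding on random subcubes. -/

section Cube

variable {S : Type u} {G : Type v} [Fintype S] [AddCommGroup S] [AddCommGroup G]

lemma LowDeg.le_pr {k d : ℕ} {Q : (Fin k → S) → G} (hQ : LowDeg d Q) (hne : ∃ z, Q z ≠ 0) :
    1 / (Fintype.card S : ℝ) ^ d ≤ pr fun z => Q z ≠ 0 := by
  classical
  have : Nonempty S := ⟨0⟩
  have hs : (0 : ℝ) < Fintype.card S := by exact_mod_cast Fintype.card_pos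
  have h := hQ.card_le_card_support_mul hne
  rw [Nat.card_eq_fintype_card (α := Fin k → S)] at h
  rw [pr_eq_card_div, div_le_div_iff₀ (by positivity) (by exact_mod_cast Fintype.card_pos), one_mul]
  exact_mod_cast h

open Classical in
/-- Unique decoding on a cube: the value at the origin of the function of degree at most `d`
that is close to the given one. -/
noncomputable def cubeDecode (d : ℕ) {k : ℕ} (g : (Fin k → S) → G) : G :=
  if h : ∃ Q : (Fin k → S) → G, LowDeg d Q ∧
    pr (fun z => g z ≠ Q z) < 1 / (Fintype.card S : ℝ) ^ d / 2 then h.choose 0 else 0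

lemma cubeDecode_eq {d k : ℕ} {g Q : (Fin k → S) → G} (hQ : LowDeg d Q)
    (h : pr (fun z => g z ≠ Q z) < 1 / (Fintype.card S : ℝ) ^ d / 2) : cubeDecode d g = Q 0 := by
  have hex : ∃ Q : (Fin k → S) → G, LowDeg d Q ∧
    pr (fun z => g z ≠ Q z) < 1 / (Fintype.card S : ℝ) ^ d / 2 := ⟨Q, hQ, h⟩
  rw [cubeDecode, dif_pos hex]
  obtain ⟨h1, h2⟩ := hex.choose_spec
  by_contra hne
  have h3 := (hQ.sub h1).le_pr ⟨0, by rw [sub_ne_zero]; exact fun h => hne h.symm⟩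
  have h4 : pr (fun z => Q z - hex.choose z ≠ 0)
      ≤ pr fun z => g z ≠ Q z ∨ g z ≠ hex.choose z := by
    refine pr_mono fun z hz => ?_
    by_contra! hcon
    exact hz (by rw [← hcon.1, ← hcon.2, sub_self])
  linarith [pr_or_le (fun z => g z ≠ Q z) fun z => g z ≠ hex.choose z]

/-- Decoding on the random subcube `z ↦ x + z ∘ h`. -/
noncomputable def cubeMap (d : ℕ) {n k : ℕ} (h : Fin n → Fin k) (f : (Fin n → S) → G)
    (x : Fin n → S) : G :=
  cubeDecode d fun z : Fin k → S => f (x + z ∘ h)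

lemma local_cubeMap (d : ℕ) {n k : ℕ} (h : Fin n → Fin k) :
    Local (Fintype.card S ^ k) (cubeMap (S := S) (G := G) d h) := by
  classical
  intro x
  refine ⟨Finset.univ.image fun z : Fin k → S => x + z ∘ h, ?_, fun f f' hff => ?_⟩
  · refine Finset.card_image_le.trans ?_
    simp
  · rw [cubeMap, cubeMap]
    congr 1
    funext z
    exact hff _ (by simp)

/-- The restriction of P to the subcube has degree at most d and value P x at the origin, so unique
decoding can fail only with at least half the minimum distance in errors. -/
lemma le_pr_of_cubeMap_ne {d n k : ℕ} {h : Fin n → Fin k} {f P : (Fin n → S) → G}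
    (hP : LowDeg d P) {x : Fin n → S} (hne : cubeMap d h f x ≠ P x) :
    1 / (Fintype.card S : ℝ) ^ d / 2 ≤ pr fun z : Fin k → S => f (x + z ∘ h) ≠ P (x + z ∘ h) := by
  by_contra! hcon
  have := cubeDecode_eq (Q := fun z : Fin k → S => P (x + z ∘ h)) (hP.comp h fun i a => x i + a) hcon
  apply hne
  rw [cubeMap, this]
  congr 1
  funext i
  simp

lemma sq_pr {X : Type*} [Fintype X] (p : X → Prop) :
    pr p ^ 2 = 𝔼 z, 𝔼 z', pr fun _ : Unit => p z ∧ p z' := by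
  classical
  rw [sq]
  conv_lhs => rw [pr]
  rw [Fintype.expect_mul_expect]
  refine Finset.expect_congr rfl fun z _ => Finset.expect_congr rfl fun z' _ => ?_
  by_cases h1 : p z <;> by_cases h2 : p z' <;> simp [pr, h1, h2]

/-- The pairs of words to which small-set expansion with exponent `1 + γ` applies. -/
def Balanced (γ : ℝ) {k : ℕ} (z z' : Fin k → S) : Prop :=
  ∀ c, (1 - slack (Fintype.card S) γ) / Fintype.card S ≤ freq (z - z') c

/-- The second moment of the fraction of T in the subcube averages, over pairs z, z', the
probability that both points lie in T. Unbalanced pairs cost at most κ; the others are bounded by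
expansion. -/
lemma expect_expect_sq_sub_le (hS : 2 ≤ Fintype.card S) {γ : ℝ} (hγ : 0 < γ) (hγ1 : γ ≤ 1) {k : ℕ}
    (hk : 0 < k) {κ : ℝ} (hκ : 𝔼 z : Fin k → S, pr (fun z' => ¬ Balanced γ z z') ≤ κ) {n : ℕ}
    (T : (Fin n → S) → Prop) :
    𝔼 h : Fin n → Fin k, 𝔼 x, (pr (fun z : Fin k → S => T (x + z ∘ h)) - pr T) ^ 2 ≤ κ + 2 * γ := by
  classical
  have : Nonempty S := ⟨0⟩
  have : Nonempty (Fin k) := ⟨⟨0, hk⟩⟩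
  set τ := pr T with hτ
  have hτ0 : 0 ≤ τ := pr_nonneg _
  have hτ1 : τ ≤ 1 := pr_le_one _
  have hmean : ∀ h : Fin n → Fin k, 𝔼 x, pr (fun z : Fin k → S => T (x + z ∘ h)) = τ := by
    intro h
    simp only [pr]
    rw [Finset.expect_comm]
    rw [Finset.expect_congr rfl (g := fun _ => τ), Fintype.expect_const]
    intro z _
    exact Fintype.expect_equiv (Equiv.addRight (z ∘ h)) _ _ fun x => rfl
  have hsecond : 𝔼 h : Fin n → Fin k, 𝔼 x, pr (fun z : Fin k → S => T (x + z ∘ h)) ^ 2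
      ≤ κ + τ ^ (2 / (1 + γ)) := by
    have e : 𝔼 h : Fin n → Fin k, 𝔼 x, pr (fun z : Fin k → S => T (x + z ∘ h)) ^ 2
        = 𝔼 z : Fin k → S, 𝔼 z' : Fin k → S, 𝔼 h : Fin n → Fin k,
          pr (fun x => T (x + z ∘ h) ∧ T (x + z' ∘ h)) := by
      simp only [sq_pr]
      simp only [pr, Finset.univ_unique, Finset.expect_singleton]
      have swap : ∀ {X : Type u} [Fintype X] (F : X → (Fin k → S) → (Fin k → S) → ℝ),
          𝔼 x, 𝔼 z, 𝔼 z', F x z z' = 𝔼 z, 𝔼 z', 𝔼 x, F x z z' := by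
        intro X _ F
        rw [Finset.expect_comm]
        exact Finset.expect_congr rfl fun z _ => Finset.expect_comm _ _ _
      simp only [swap]
      rw [Finset.expect_comm]
      exact Finset.expect_congr rfl fun z _ => Finset.expect_comm _ _ _
    rw [e]
    calc _ ≤ 𝔼 z : Fin k → S, 𝔼 z' : Fin k → S,
          ((if ¬ Balanced γ z z' then 1 else 0) + τ ^ (2 / (1 + γ))) := by
          refine Finset.expect_le_expect fun z _ => Finset.expect_le_expect fun z' _ => ?_
          by_cases hb : Balanced γ z z'
          · rw [if_neg (by simpa using hb), zero_add]
            exact pr_and_le_rpow hS hγ hγ1 hk hb n T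
          · rw [if_pos hb]
            have h1 : 𝔼 h : Fin n → Fin k, pr (fun x => T (x + z ∘ h) ∧ T (x + z' ∘ h)) ≤ 1 :=
              Finset.expect_le Finset.univ_nonempty fun h _ => pr_le_one _
            have h2 : 0 ≤ τ ^ (2 / (1 + γ)) := by positivity
            linarith
      _ = 𝔼 z : Fin k → S, pr (fun z' => ¬ Balanced γ z z') + τ ^ (2 / (1 + γ)) := by
          simp only [Finset.expect_add_distrib, Fintype.expect_const, pr]
          congr!
      _ ≤ _ := by linarith
  -- With a = 2γ / (1 + γ) the power is the weighted geometric mean of τ² and τ with weights 1 - a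
  -- and a.
  have hpow : τ ^ (2 / (1 + γ)) ≤ τ ^ 2 + 2 * γ := by
    have hp : 0 < 1 + γ := by linarith
    set a := 2 * γ / (1 + γ) with ha
    have ha0 : 0 ≤ a := by positivity
    have ha1 : a ≤ 1 := by rw [ha, div_le_one hp]; linarith
    have ha2 : a ≤ 2 * γ := by
      rw [ha, div_le_iff₀ hp]; nlinarith
    have := Real.geom_mean_le_arith_mean2_weighted (w₁ := 1 - a) (w₂ := a) (p₁ := τ ^ 2) (p₂ := τ)
      (by linarith) ha0 (by positivity) hτ0 (by ring)
    have e : (τ ^ 2) ^ (1 - a) * τ ^ a = τ ^ (2 / (1 + γ)) := by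
      rw [← Real.rpow_natCast, ← Real.rpow_mul hτ0, ← Real.rpow_add_of_nonneg hτ0
        (by push_cast; nlinarith) ha0]
      congr 1
      rw [ha]; push_cast; field_simp; ring
    rw [e] at this
    nlinarith [mul_nonneg ha0 (sq_nonneg τ), mul_le_mul_of_nonneg_left hτ1 ha0]
  have hexp : ∀ (h : Fin n → Fin k) (x : Fin n → S),
      (pr (fun z : Fin k → S => T (x + z ∘ h)) - τ) ^ 2
        = pr (fun z : Fin k → S => T (x + z ∘ h)) ^ 2
          - 2 * τ * pr (fun z : Fin k → S => T (x + z ∘ h)) + τ ^ 2 := fun h x => by ring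
  simp only [hexp, Finset.expect_add_distrib, Finset.expect_sub_distrib, ← Finset.mul_expect,
    hmean, Fintype.expect_const]
  nlinarith

lemma expect_pr_cubeMap_ne_mul_le (hS : 2 ≤ Fintype.card S) {γ : ℝ} (hγ : 0 < γ) (hγ1 : γ ≤ 1)
    {k : ℕ} (hk : 0 < k) {κ : ℝ} (hκ : 𝔼 z : Fin k → S, pr (fun z' => ¬ Balanced γ z z') ≤ κ)
    {n d : ℕ} {f P : (Fin n → S) → G} (hP : LowDeg d P) {ε : ℝ} (hε : 0 < ε)
    (hf : pr (fun x => f x ≠ P x) ≤ 1 / (Fintype.card S : ℝ) ^ d / 2 - ε) :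
    (𝔼 h : Fin n → Fin k, pr fun x => cubeMap d h f x ≠ P x) * ε ^ 2 ≤ κ + 2 * γ := by
  refine le_trans ?_ (expect_expect_sq_sub_le hS hγ hγ1 hk hκ fun x => f x ≠ P x)
  rw [Finset.expect_mul]
  refine Finset.expect_le_expect fun h _ => pr_mul_le (fun x => sq_nonneg _) fun x hx => ?_
  have := le_pr_of_cubeMap_ne hP hx
  exact pow_le_pow_left₀ hε.le (by linarith) 2

/-- A wrongly decoded subcube has so many errors that not all pairs of them can be unbalanced. Hence
some balanced pair consists of two errors, and a union bound over at most s^(2k) pairs applies. -/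
lemma expect_pr_cubeMap_ne_le (hS : 2 ≤ Fintype.card S) {γ : ℝ} (hγ : 0 < γ) (hγ1 : γ ≤ 1)
    {k : ℕ} (hk : 0 < k) {n d : ℕ}
    (hκ : 𝔼 z : Fin k → S, pr (fun z' => ¬ Balanced γ z z')
      < (1 / (Fintype.card S : ℝ) ^ d / 2) ^ 2)
    {f P : (Fin n → S) → G} (hP : LowDeg d P) :
    𝔼 h : Fin n → Fin k, pr (fun x => cubeMap d h f x ≠ P x)
      ≤ (Fintype.card S : ℝ) ^ (2 * k) * pr (fun x => f x ≠ P x) ^ (2 / (1 + γ)) := by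
  classical
  have : Nonempty S := ⟨0⟩
  have : Nonempty (Fin k) := ⟨⟨0, hk⟩⟩
  set T : (Fin n → S) → Prop := fun x => f x ≠ P x
  set B := Finset.univ.filter fun y : (Fin k → S) × (Fin k → S) => Balanced γ y.1 y.2 with hB
  have h1 : ∀ h : Fin n → Fin k, pr (fun x => cubeMap d h f x ≠ P x)
      ≤ ∑ y ∈ B, pr fun x => T (x + y.1 ∘ h) ∧ T (x + y.2 ∘ h) := by
    intro h
    refine (pr_mono fun x hx => ?_).trans
      (pr_exists_le B fun y x => T (x + y.1 ∘ h) ∧ T (x + y.2 ∘ h))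
    have h2 := le_pr_of_cubeMap_ne hP hx
    by_contra! hcon
    have h3 : pr (fun z : Fin k → S => T (x + z ∘ h)) ^ 2
        ≤ 𝔼 z : Fin k → S, pr (fun z' => ¬ Balanced γ z z') := by
      rw [sq_pr]
      refine Finset.expect_le_expect fun z _ => ?_
      conv_rhs => rw [pr]
      refine Finset.expect_le_expect fun z' _ => ?_
      by_cases hb : Balanced γ z z'
      · have h4 := hcon (z, z') (by simpa [hB] using hb)
        simp only [pr, Finset.univ_unique, Finset.expect_singleton]
        rw [if_neg (fun h5 => h4 h5.1 h5.2), if_neg (by simpa using hb)]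
      · rw [if_pos hb]
        exact pr_le_one _
    have h4 := pow_le_pow_left₀ (by positivity) h2 2
    linarith
  calc _ ≤ 𝔼 h : Fin n → Fin k, ∑ y ∈ B, pr (fun x => T (x + y.1 ∘ h) ∧ T (x + y.2 ∘ h)) :=
        Finset.expect_le_expect fun h _ => h1 h
    _ = ∑ y ∈ B, 𝔼 h : Fin n → Fin k, pr (fun x => T (x + y.1 ∘ h) ∧ T (x + y.2 ∘ h)) :=
        Finset.expect_sum_comm _ _ _
    _ ≤ ∑ y ∈ B, pr T ^ (2 / (1 + γ)) := Finset.sum_le_sum fun y hy =>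
        pr_and_le_rpow hS hγ hγ1 hk (Finset.mem_filter.mp hy).2 n T
    _ = B.card * pr T ^ (2 / (1 + γ)) := by rw [Finset.sum_const, nsmul_eq_mul]
    _ ≤ _ := by
        refine mul_le_mul_of_nonneg_right ?_ (Real.rpow_nonneg (pr_nonneg _) _)
        have : B.card ≤ Fintype.card S ^ (2 * k) := by
          refine (Finset.card_le_univ _).trans_eq ?_
          simp only [Fintype.card_prod, Fintype.card_fun, Fintype.card_fin]
          ring
        exact_mod_cast this

end Cube

/-! ### Error reduction with a constant number of queries, and its iteration. -/

lemma exists_card_pow_div_le (s : ℕ) {μ κ : ℝ} (hμ : 0 < μ) (hκ : 0 < κ) :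
    ∃ k : ℕ, 0 < k ∧ (s : ℝ) ^ 3 / (k * μ ^ 2) ≤ κ := by
  obtain ⟨k, hk⟩ := exists_nat_gt ((s : ℝ) ^ 3 / (κ * μ ^ 2))
  have h0 : (0 : ℝ) < k := lt_of_le_of_lt (by positivity) hk
  refine ⟨k, by exact_mod_cast h0, ?_⟩
  rw [div_lt_iff₀ (by positivity)] at hk
  rw [div_le_iff₀ (by positivity)]
  nlinarith

/-- From the unique decoding radius to an arbitrarily small constant distance. -/
lemma exists_reduces_const (s d : ℕ) (hs : 2 ≤ s) {ε η θ : ℝ} (hε : 0 < ε) (hη : 0 < η)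
    (hθ : 0 < θ) :
    ∃ q : ℕ, ∀ (S : Type u) [Fintype S] [AddCommGroup S], Fintype.card S = s →
      ∀ (G : Type v) [AddCommGroup G] (n : ℕ),
        Reduces S G n d q (1 / (s : ℝ) ^ d / 2 - ε) η θ := by
  set κ := η * θ * ε ^ 2 / 2 with hκ
  have hκ0 : 0 < κ := by positivity
  set γ := min 1 (κ / 2) with hγ
  have hγ0 : 0 < γ := lt_min one_pos (by positivity)
  have hγ1 : γ ≤ 1 := min_le_left _ _
  have hγ2 : γ ≤ κ / 2 := min_le_right _ _
  have hμ : 0 < slack s γ := slack_pos (by exact_mod_cast hs) hγ0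
  obtain ⟨k, hk, hkκ⟩ := exists_card_pow_div_le s hμ hκ0
  refine ⟨s ^ k, ?_⟩
  rintro S _ _ rfl G _ n
  have : Nonempty (Fin k) := ⟨⟨0, hk⟩⟩
  refine ⟨Fin n → Fin k, inferInstance, inferInstance, cubeMap d, local_cubeMap d,
    fun f P hP hf => ?_⟩
  have h1 := expect_pr_cubeMap_ne_mul_le hs hγ0 hγ1 hk
    ((pr_unbalanced_le hμ hk).trans hkκ) hP hε hf
  have h2 := pr_mul_le (p := fun h : Fin n → Fin k => η < pr fun x => cubeMap d h f x ≠ P x)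
    (f := fun h => pr fun x => cubeMap d h f x ≠ P x) (fun _ => pr_nonneg _) (a := η)
    (fun _ h => h.le)
  -- Chebyshev spends ε ^ 2 and Markov spends η, which dictates κ and γ.
  have h3 : κ + 2 * γ ≤ θ * η * ε ^ 2 := by rw [hκ] at hγ2 ⊢; linarith
  have h4 := le_of_mul_le_mul_right (h1.trans h3) (by positivity)
  exact le_of_mul_le_mul_right (h2.trans h4) hη

/-- A constant number of queries raises a small distance to the power `5 / 4`. -/
lemma exists_reduces_rpow (s d : ℕ) (hs : 2 ≤ s) :
    ∃ (q : ℕ) (C : ℝ), 0 < q ∧ 0 < C ∧ ∀ (S : Type u) [Fintype S] [AddCommGroup S],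
      Fintype.card S = s → ∀ (G : Type v) [AddCommGroup G] (n : ℕ) (τ : ℝ), 0 < τ →
        Reduces S G n d q τ (τ ^ (5 / 4 : ℝ)) (C * τ ^ (1 / 4 : ℝ)) := by
  have hs0 : (0 : ℝ) < s := by exact_mod_cast (by omega : 0 < s)
  have hμ : 0 < slack s (1 / 3) := slack_pos (by exact_mod_cast hs) (by norm_num)
  obtain ⟨k, hk, hkκ⟩ := exists_card_pow_div_le s hμ
    (κ := (1 / (s : ℝ) ^ d / 2) ^ 2 / 2) (by positivity)
  refine ⟨s ^ k, (s : ℝ) ^ (2 * k), by positivity, by positivity, ?_⟩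
  rintro S _ _ rfl G _ n τ hτ
  have : Nonempty (Fin k) := ⟨⟨0, hk⟩⟩
  refine ⟨Fin n → Fin k, inferInstance, inferInstance, cubeMap d, local_cubeMap d,
    fun f P hP hf => ?_⟩
  have h1 := expect_pr_cubeMap_ne_le (f := f) hs (γ := 1 / 3) (by norm_num) (by norm_num) hk
    (((pr_unbalanced_le hμ hk).trans hkκ).trans_lt (half_lt_self (by positivity))) hP
  have h2 := pr_mul_le
    (p := fun h : Fin n → Fin k => τ ^ (5 / 4 : ℝ) < pr fun x => cubeMap d h f x ≠ P x)
    (f := fun h => pr fun x => cubeMap d h f x ≠ P x) (fun _ => pr_nonneg _) (a := τ ^ (5 / 4 : ℝ))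
    (fun _ h => h.le)
  -- For γ = 1/3 the exponent is 3/2 = 1/4 + 5/4: Markov at level τ^(5/4) leaves failure probability
  -- of order τ^(1/4).
  have h3 : pr (fun x => f x ≠ P x) ^ (2 / (1 + 1 / 3) : ℝ) ≤ τ ^ (1 / 4 : ℝ) * τ ^ (5 / 4 : ℝ) := by
    rw [← Real.rpow_add hτ]
    refine (Real.rpow_le_rpow (pr_nonneg _) hf (by norm_num)).trans_eq ?_
    norm_num
  have h4 : (0 : ℝ) < τ ^ (5 / 4 : ℝ) := by positivity
  refine le_of_mul_le_mul_right (h2.trans (h1.trans ?_)) h4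
  rw [mul_assoc]
  exact mul_le_mul_of_nonneg_left h3 (by positivity)

/-- Iteration of `exists_reduces_rpow`. -/
lemma Reduces.iterate {S : Type u} {G : Type v} [Fintype S] [AddCommGroup G] {n d q : ℕ} {C : ℝ}
    (hC : 0 < C)
    (h : ∀ τ : ℝ, 0 < τ → Reduces S G n d q τ (τ ^ (5 / 4 : ℝ)) (C * τ ^ (1 / 4 : ℝ)))
    (t : ℕ) {τ : ℝ} (hτ : 0 < τ) (hτ1 : τ ≤ 1 / 2 ^ 16) :
    Reduces S G n d (q ^ t) τ (τ ^ ((5 / 4 : ℝ) ^ t)) (2 * C * τ ^ (1 / 4 : ℝ)) := by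
  induction t generalizing τ with
  | zero => simpa using Reduces.refl (by positivity)
  | succ t ih =>
    have hle : τ ^ (5 / 4 : ℝ) ≤ 1 / 2 ^ 16 :=
      (Real.rpow_le_rpow_of_exponent_ge hτ (hτ1.trans (by norm_num))
        (by norm_num : (1 : ℝ) ≤ 5 / 4)).trans (by rwa [Real.rpow_one])
    have h1 := (h τ hτ).comp (ih (by positivity) hle) (by positivity)
    rw [pow_succ']
    refine h1.mono ?_ (le_of_eq ?_)
    -- The remaining failure bound gains a factor τ^(1/16) ≤ 1/2, so the total stays below twice the
    -- first term; hence the threshold 1 / 2 ^ 16.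
    · have h2 : (τ ^ (5 / 4 : ℝ)) ^ (1 / 4 : ℝ) = τ ^ (1 / 4 : ℝ) * τ ^ (1 / 16 : ℝ) := by
        rw [← Real.rpow_mul hτ.le, ← Real.rpow_add hτ]; norm_num
      have h3 : τ ^ (1 / 16 : ℝ) ≤ 1 / 2 := by
        refine (Real.rpow_le_rpow hτ.le hτ1 (by norm_num)).trans_eq ?_
        have : (1 / 2 ^ 16 : ℝ) = (1 / 2) ^ (16 : ℝ) := by norm_num
        rw [this, ← Real.rpow_mul (by norm_num)]
        norm_num
      rw [h2]
      have h4 : 0 < C * τ ^ (1 / 4 : ℝ) := by positivity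
      nlinarith
    · rw [← Real.rpow_mul hτ.le, ← pow_succ']

end JuntaCorrection

namespace JuntaCorrection

open scoped BigOperators

/-! ### Correction by interpolation along a random set function. -/

section Interpolation

lemma expect_comp_le {I S : Type*} [Fintype I] [Fintype S] [Nonempty S] {ρ : ℝ} (α : I → S)
    (hα : ∀ v, pr (fun i => α i = v) ≤ ρ / Fintype.card S) {R : S → ℝ} (hR : ∀ v, 0 ≤ R v) :
    𝔼 i, R (α i) ≤ ρ * 𝔼 v, R v := by
  classical
  have h1 : ∀ i, R (α i) = ∑ v, (if α i = v then (1 : ℝ) else 0) * R v := by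
    intro i; simp
  simp only [h1]
  have h2 : ρ * 𝔼 v, R v = ∑ v, ρ / Fintype.card S * R v := by
    rw [Fintype.expect_eq_sum_div_card, ← Finset.mul_sum]
    ring
  rw [Finset.expect_sum_comm, h2]
  refine Finset.sum_le_sum fun v _ => ?_
  rw [← Finset.expect_mul]
  refine mul_le_mul_of_nonneg_right ?_ (hR v)
  have := hα v
  rw [pr] at this
  convert this

/-- A density bound ρ relative to the uniform distribution in each independent coordinate multiplies
to ρ ^ n. -/
lemma expect_pi_comp_le {I S : Type*} [Fintype I] [Fintype S] [Nonempty S] {ρ : ℝ} (hρ : 0 ≤ ρ)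
    {n : ℕ} (α : Fin n → I → S) (hα : ∀ j v, pr (fun i => α j i = v) ≤ ρ / Fintype.card S)
    {R : (Fin n → S) → ℝ} (hR : ∀ v, 0 ≤ R v) :
    𝔼 ω : Fin n → I, R (fun j => α j (ω j)) ≤ ρ ^ n * 𝔼 v, R v := by
  induction n with
  | zero =>
    simp only [Finset.univ_unique, Finset.expect_singleton, pow_zero, one_mul]
    exact le_of_eq (congrArg R (Subsingleton.elim _ _))
  | succ n ih =>
    rw [expect_fin_succ, expect_fin_succ]
    have h1 : ∀ i : I, 𝔼 ω : Fin n → I, R (fun j => α j ((Fin.cons i ω : Fin (n + 1) → I) j))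
        ≤ ρ ^ n * 𝔼 w : Fin n → S, R (Fin.cons (α 0 i) w) := by
      intro i
      refine le_trans (le_of_eq ?_) (ih (fun j => α j.succ) (fun j => hα j.succ)
        (R := fun w => R (Fin.cons (α 0 i) w)) fun w => hR _)
      refine Finset.expect_congr rfl fun ω _ => congrArg R ?_
      funext j
      refine Fin.cases ?_ (fun j => ?_) j <;> simp
    refine (Finset.expect_le_expect fun i _ => h1 i).trans ?_
    rw [← Finset.mul_expect, pow_succ, mul_assoc]
    exact mul_le_mul_of_nonneg_left (expect_comp_le (α 0) (hα 0)
      (R := fun a => 𝔼 w : Fin n → S, R (Fin.cons a w))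
      fun a => Finset.expect_nonneg fun w _ => hR _) (by positivity)

lemma Corrects.mono {S : Type u} {G : Type v} [Fintype S] [AddCommGroup G] {n d q q' : ℕ} {δ θ θ' : ℝ} (h : Corrects S G n d q δ θ) (hq : q ≤ q')
    (hθ : θ ≤ θ') : Corrects S G n d q' δ θ' := by
  obtain ⟨Ω, i, j, Φ, hΦ, hf⟩ := h
  refine ⟨Ω, i, j, Φ, fun ω x => ?_, fun f P hP hd x => (hf f P hP hd x).trans hθ⟩
  obtain ⟨Z, hZ, h⟩ := hΦ ω x
  exact ⟨Z, hZ.trans hq, h⟩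

variable {S : Type u} {G : Type v} [Fintype S] [AddCommGroup S] [AddCommGroup G]

/-- Correction by interpolation: if the values of a function of degree at most `d` on the sets
in `Z` determine its value at `∅`, and the sets in `Z` have the right density with respect to the
random position, then oracles at small distance are corrected. -/
lemma corrects_of_interpolation (hS : 2 ≤ Fintype.card S) {α U : Type u} [DecidableEq α]
    [Fintype U] [Nonempty U] (pos : U → α) (Z : Finset (Finset α)) {d : ℕ}
    (hZ : ∀ q : Finset α → G, SetDeg d q → (∀ A ∈ Z, q A = 0) → q ∅ = 0) {ρ : ℝ} (hρ : 0 ≤ ρ)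
    (h0 : ∀ A ∈ Z, pr (fun u => pos u ∉ A) ≤ ρ / Fintype.card S)
    (h1 : ∀ A ∈ Z, pr (fun u => pos u ∈ A) ≤ ρ / Fintype.card S * (Fintype.card S - 1))
    (n : ℕ) (δ : ℝ) : Corrects S G n d Z.card δ (Z.card * (ρ ^ n * δ)) := by
  classical
  have : Nontrivial S := Fintype.one_lt_card_iff_nontrivial.mp (by omega)
  obtain ⟨e₀, he₀⟩ := exists_ne (0 : S)
  have : Nonempty {e : S // e ≠ 0} := ⟨⟨e₀, he₀⟩⟩
  let dec : (Finset α → G) → G := fun g =>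
    if h : ∃ q : Finset α → G, SetDeg d q ∧ ∀ A ∈ Z, q A = g A then h.choose ∅ else 0
  have hdec : ∀ g q : Finset α → G, SetDeg d q → (∀ A ∈ Z, g A = q A) → dec g = q ∅ := by
    intro g q hq hg
    have h : ∃ q : Finset α → G, SetDeg d q ∧ ∀ A ∈ Z, q A = g A :=
      ⟨q, hq, fun A hA => (hg A hA).symm⟩
    simp only [dec, dif_pos h]
    have := hZ _ (h.choose_spec.1.sub hq) fun A hA => by
      rw [h.choose_spec.2 A hA, hg A hA, sub_self]
    exact sub_eq_zero.mp this
  have hdec' : ∀ g g' : Finset α → G, (∀ A ∈ Z, g A = g' A) → dec g = dec g' := by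
    intro g g' hg
    have : (fun q : Finset α → G => SetDeg d q ∧ ∀ A ∈ Z, q A = g A)
        = fun q => SetDeg d q ∧ ∀ A ∈ Z, q A = g' A := by
      funext q
      refine propext (and_congr_right fun _ => forall₂_congr fun A hA => by rw [hg A hA])
    have key : ∀ p p' : (Finset α → G) → Prop, p = p' →
        (if h : ∃ q, p q then h.choose ∅ else 0) = if h : ∃ q, p' q then h.choose ∅ else 0 := by
      rintro p _ rfl
      rfl
    exact key _ _ this
  -- The set ∅ gives x itself. For fixed A the coordinates are independent over ω.
  let y : (Fin n → S) → (Fin n → U × {e : S // e ≠ 0}) → Finset α → Fin n → S := fun x ω A i =>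
    if pos (ω i).1 ∈ A then x i + (ω i).2 else x i
  refine ⟨Fin n → U × {e : S // e ≠ 0}, inferInstance, inferInstance,
    fun ω f x => dec fun A => f (y x ω A), fun ω x => ⟨Z.image (y x ω), Finset.card_image_le,
      fun f f' hff => hdec' _ _ fun A hA => hff _ (Finset.mem_image_of_mem _ hA)⟩,
    fun f P hP hd x => ?_⟩
  have hfail : pr (fun ω => (dec fun A => f (y x ω A)) ≠ P x)
      ≤ ∑ A ∈ Z, pr fun ω => f (y x ω A) ≠ P (y x ω A) := by
    refine (pr_mono fun ω hω => ?_).trans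
      (pr_exists_le Z fun A ω => f (y x ω A) ≠ P (y x ω A))
    by_contra! hcon
    refine hω ?_
    rw [hdec _ (fun A => P (y x ω A))
      (hP.setDeg (fun i => pos (ω i).1) x fun i => x i + (ω i).2) hcon]
    simp [y]
  refine hfail.trans ?_
  rw [← nsmul_eq_mul]
  refine Finset.sum_le_card_nsmul _ _ _ fun A hA => ?_
  have hs1 : (0 : ℝ) < Fintype.card S - 1 := by
    have : (2 : ℝ) ≤ Fintype.card S := by exact_mod_cast hS
    linarith
  -- The shift is nonzero, so the letter a survives exactly when the position is outside A; every
  -- other letter needs a position in A and one specific shift, of probability 1 / (s - 1).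
  have hfib : ∀ (a v : S), pr (fun i : U × {e : S // e ≠ 0} =>
      (if pos i.1 ∈ A then a + i.2 else a) = v) ≤ ρ / Fintype.card S := by
    intro a v
    by_cases hv : v = a
    · subst hv
      refine le_trans (le_of_eq ?_) (h0 A hA)
      rw [pr_prod]
      refine Finset.expect_congr rfl fun u _ => ?_
      by_cases hu : pos u ∈ A
      · rw [if_neg fun h => h hu, pr]
        exact Finset.expect_eq_zero fun e _ => if_neg (by simp [hu, e.2])
      · rw [if_pos hu, pr]
        refine (Finset.expect_congr rfl fun e _ => if_pos ?_).trans (Fintype.expect_const 1)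
        simp [hu]
    · have hE : pr (fun e : {e : S // e ≠ 0} => a + e = v) = 1 / (Fintype.card S - 1) := by
        have hva : v - a ≠ 0 := sub_ne_zero.mpr hv
        rw [pr, Fintype.expect_eq_sum_div_card, Finset.sum_eq_single ⟨v - a, hva⟩]
        · rw [if_pos (by simp), Fintype.card_subtype_compl, Fintype.card_subtype_eq,
            Nat.cast_sub (by omega), Nat.cast_one]
        · intro e _ he
          rw [if_neg]
          intro h
          apply he
          apply Subtype.ext
          simp [← h]
        · simp
      calc _ = pr (fun u => pos u ∈ A) * (1 / (Fintype.card S - 1)) := by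
            rw [pr_prod]
            conv_rhs => rw [pr, Finset.expect_mul]
            refine Finset.expect_congr rfl fun u _ => ?_
            by_cases hu : pos u ∈ A
            · simp only [hu, if_true, one_mul, hE]
            · simp only [hu, if_false, zero_mul]
              rw [pr]
              exact Finset.expect_eq_zero fun e _ => if_neg fun h => hv h.symm
        _ ≤ ρ / Fintype.card S * (Fintype.card S - 1) * (1 / (Fintype.card S - 1)) := by
            gcongr
            exact h1 A hA
        _ = ρ / Fintype.card S := by field_simp
  have := expect_pi_comp_le hρ (fun j (i : U × {e : S // e ≠ 0}) =>
    if pos i.1 ∈ A then x j + i.2 else x j) (fun j v => hfib (x j) v)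
    (R := fun v => if f v ≠ P v then (1 : ℝ) else 0) fun v => by split_ifs <;> norm_num
  have e1 : pr (fun ω => f (y x ω A) ≠ P (y x ω A)) =
      𝔼 ω, if f (y x ω A) ≠ P (y x ω A) then (1 : ℝ) else 0 := by rw [pr]; congr!
  rw [e1]
  refine this.trans (mul_le_mul_of_nonneg_left (le_trans (le_of_eq ?_) hd) (by positivity))
  rw [pr]
  congr!

end Interpolation

/-! ### Final correction in bounded exponent. -/

section Torsion

/-- Correction from a small constant distance with a constant number of queries, for groups of
bounded exponent. -/
lemma exists_corrects_torsion (s d M : ℕ) (hs : 2 ≤ s) (hM : 0 < M) :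
    ∃ N : ℕ, 0 < N ∧ ∀ (S : Type u) [Fintype S] [AddCommGroup S], Fintype.card S = s →
      ∀ (G : Type v) [AddCommGroup G], (∀ g : G, M • g = 0) → ∀ (n : ℕ) (δ : ℝ), 0 ≤ δ →
        Corrects S G n d N δ (N * δ) := by
  classical
  -- With s * L positions and slice w = (s - 1) * L, the density is exactly 1 - 1/s, so ρ = 1. The
  -- complement, of size L, provides the room, and M^d divides w, so ∅ lies in the residue class of
  -- w.
  set L := M ^ d * (sliceRoom M d + d + 1) with hL
  have hMd : 0 < M ^ d := by positivity
  have hLge : sliceRoom M d + d + 1 ≤ L := Nat.le_mul_of_pos_left _ hMd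
  refine ⟨2 ^ (L * s), by positivity, ?_⟩
  rintro S _ _ rfl G _ hG n δ hδ
  set s := Fintype.card S with hs'
  have hLpos : 0 < L := by omega
  have : Nonempty (Fin L) := ⟨⟨0, hLpos⟩⟩
  set w := (s - 1) * L with hw
  have hLw : L ≤ w := Nat.le_mul_of_pos_left _ (by omega)
  have hwL : w + L = L * s := by
    rw [hw, ← Nat.succ_mul, Nat.succ_eq_add_one, Nat.sub_add_cancel (by omega), mul_comm]
  have hcardU : Fintype.card (Fin L × S) = L * s := by simp [hs']
  let Z : Finset (Finset (Fin L × S)) := Finset.univ.filter fun A => A.card = w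
  have hZc : Z.card ≤ 2 ^ (L * s) := by
    refine (Finset.card_le_univ _).trans_eq ?_
    rw [Fintype.card_finset, hcardU]
  have hs0 : (0 : ℝ) < s := by exact_mod_cast (by omega : 0 < s)
  have hL0 : (0 : ℝ) < L := by exact_mod_cast hLpos
  have hmem : ∀ A ∈ Z, pr (fun u : Fin L × S => u ∈ A) = (1 : ℝ) / s * (s - 1) := by
    intro A hA
    rw [pr_eq_card_div, hcardU, Nat.card_eq_fintype_card, Fintype.card_coe,
      (Finset.mem_filter.mp hA).2, hw]
    push_cast [Nat.cast_sub (show 1 ≤ s by omega)]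
    field_simp
  have hadd : ∀ A : Finset (Fin L × S),
      pr (fun u : Fin L × S => u ∉ A) + pr (fun u : Fin L × S => u ∈ A) = 1 := by
    intro A
    rw [pr, pr, ← Finset.expect_add_distrib, ← Fintype.expect_one (ι := Fin L × S) (M := ℝ)]
    refine Finset.expect_congr rfl fun u _ => ?_
    by_cases hu : u ∈ A <;> simp [hu]
  have h := corrects_of_interpolation (G := G) hs (α := Fin L × S) (U := Fin L × S) id Z (d := d)
    ?_ (ρ := 1) zero_le_one ?_ (fun A hA => (hmem A hA).le) n δ
  · refine h.mono hZc ?_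
    rw [one_pow, one_mul]
    gcongr
  · intro q hq hq0
    refine hq.eq_zero_of_slice hM hG ∅ (w := w) (by omega) ?_ ?_ (by simp) ?_
    · rw [Finset.compl_empty, Finset.card_univ, hcardU]
      omega
    · intro A _ hA
      exact hq0 A (by simp [Z, hA])
    · rw [Finset.card_empty]
      refine ((Nat.modEq_zero_iff_dvd).mpr ?_).symm
      exact Dvd.dvd.mul_left (Dvd.intro _ rfl) _
  · intro A hA
    have h2 := hadd A
    rw [hmem A hA] at h2
    have h3 : (1 : ℝ) / s * (s - 1) = 1 - 1 / s := by field_simp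
    simp only [id]
    linarith

end Torsion

/-! ### Final correction with O((log n)^d) queries. -/

section Logarithmic

lemma pr_sigma_fst_mem {β : Type*} [Fintype β] [DecidableEq β] (w : β → ℕ) (X : Finset β) :
    pr (fun u : Σ p : β, Fin (w p) => u.1 ∈ X) = (∑ p ∈ X, (w p : ℝ)) / ∑ p, (w p : ℝ) := by
  classical
  rw [pr_eq_card_div, Fintype.card_sigma, Nat.card_eq_fintype_card, Fintype.card_subtype]
  have : (Finset.univ.filter fun u : Σ p : β, Fin (w p) => u.1 ∈ X)
      = X.sigma fun _ => Finset.univ := by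
    ext u; simp
  rw [this, Finset.card_sigma]
  simp

/-- Correction from distance `O(1 / log ^ d n)` with `O(log ^ d n)` queries, where `t` plays the
role of `log n`; `E` is the set of positions at each scale. -/
lemma corrects_of_conf {S E : Type u} {G : Type v} [Fintype S] [AddCommGroup S]
    [AddCommGroup G] [Fintype E] [DecidableEq E] (hS : 2 ≤ Fintype.card S) {d n t : ℕ} (hd : 0 < d)
    (ht : d * n ≤ 2 ^ t) (bit : E → Bool)
    (hbit : ∀ b, 3 * d ≤ (Finset.univ.filter fun e => bit e = b).card)
    (hbal : (Finset.univ.filter fun e => bit e = true).card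
      = (Finset.univ.filter fun e => bit e = false).card * (Fintype.card S - 1))
    {δ : ℝ} (hδ : 0 ≤ δ) :
    Corrects S G n d (((t + 1) * Fintype.card E ^ 3 + 1) ^ d) δ
      ((((t + 1) * Fintype.card E ^ 3 + 1) ^ d : ℕ) * (3 * δ)) := by
  classical
  set s := Fintype.card S with hs
  obtain ⟨Z₀, hZ₀, hZ₀c⟩ := exists_finset_conf bit t d
  set N := ((t + 1) * Fintype.card E ^ 3 + 1) ^ d
  set base : Finset (Fin (t + 1) × E) := Finset.univ.filter fun p => bit p.2 = true with hbase
  have hmem_base : ∀ p, p ∈ base ↔ bit p.2 = true := fun p => by simp [hbase]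
  clear_value base
  -- Sets are recentred at `base`, whose density is exactly 1 - 1/s. The filter discards members of
  -- `Z₀` that need not be disjoint unions of moves; every `Conf` passes it.
  set Z := (Z₀.filter fun A => |∑ p ∈ A, flipWeight bit p| ≤ (d : ℤ)).image (symmDiff base) with hZ
  have hZc : Z.card ≤ N :=
    (Finset.card_image_le.trans (Finset.card_filter_le _ _)).trans hZ₀c
  set B := (Finset.univ.filter fun e => bit e = false).card with hB
  have hB3 : 3 * d ≤ B := hbit false
  obtain ⟨e₁, -⟩ := Finset.card_pos.mp (show 0 < B by omega)
  -- Drawing a position with probability proportional to its weight is a uniform draw from the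
  -- corresponding sigma type.
  set wt : Fin (t + 1) × E → ℕ := fun p => 2 ^ (t - p.1) with hwt
  have : Nonempty (Σ p : Fin (t + 1) × E, Fin (wt p)) := ⟨⟨(0, e₁), ⟨0, by positivity⟩⟩⟩
  set V : ℝ := (∑ j : Fin (t + 1), (2 : ℝ) ^ (t - (j : ℕ))) * B with hV
  have hs1 : (1 : ℝ) ≤ s - 1 := by
    have : (2 : ℝ) ≤ s := by exact_mod_cast hS
    linarith
  have hB1 : (1 : ℝ) ≤ B := by exact_mod_cast (by omega : 1 ≤ B)
  have hV2 : (2 : ℝ) ^ t ≤ V := by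
    have h1 : (2 : ℝ) ^ t ≤ ∑ j : Fin (t + 1), (2 : ℝ) ^ (t - (j : ℕ)) := by
      have := Finset.single_le_sum (f := fun j : Fin (t + 1) => (2 : ℝ) ^ (t - (j : ℕ)))
        (fun j _ => by positivity) (Finset.mem_univ 0)
      simpa using this
    rw [hV]
    nlinarith [show (0 : ℝ) < 2 ^ t by positivity]
  have hVpos : 0 < V := lt_of_lt_of_le (by positivity) hV2
  have hcount : ∀ (b : Bool), ∑ p : Fin (t + 1) × E, (if bit p.2 = b then (wt p : ℝ) else 0)
      = (∑ j : Fin (t + 1), (2 : ℝ) ^ (t - (j : ℕ))) *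
        (Finset.univ.filter fun e => bit e = b).card := by
    intro b
    rw [Fintype.sum_prod_type, Finset.sum_mul]
    refine Finset.sum_congr rfl fun j _ => ?_
    have hj : ∀ e : E, (wt (j, e) : ℝ) = 2 ^ (t - (j : ℕ)) := fun e => by simp [hwt]
    simp only [hj]
    rw [← Finset.sum_filter, Finset.sum_const, nsmul_eq_mul, mul_comm]
  have hsum1 : ∑ p : Fin (t + 1) × E, (if bit p.2 = true then (wt p : ℝ) else 0) = V * (s - 1) := by
    rw [hcount, hbal, Nat.cast_mul, Nat.cast_sub (by omega), Nat.cast_one, ← mul_assoc]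
  have hsum0 : ∑ p : Fin (t + 1) × E, (if bit p.2 = false then (wt p : ℝ) else 0) = V := hcount false
  have hsum : ∑ p : Fin (t + 1) × E, (wt p : ℝ) = V * s := by
    have : V * s = V * (s - 1) + V := by ring
    rw [this, ← hsum1, ← hsum0, ← Finset.sum_add_distrib]
    refine Finset.sum_congr rfl fun p _ => ?_
    cases bit p.2 <;> simp
  have hind : ∀ (X : Finset (Fin (t + 1) × E)) (f : Fin (t + 1) × E → ℝ),
      ∑ p ∈ X, f p = ∑ p, if p ∈ X then f p else 0 := fun X f => by simp [Finset.sum_ite_mem]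
  have hmemsum : ∀ A : Finset (Fin (t + 1) × E), ∑ p ∈ symmDiff base A, (wt p : ℝ)
      = V * (s - 1) + ((∑ p ∈ A, flipWeight bit p : ℤ) : ℝ) := by
    intro A
    rw [← hsum1, Int.cast_sum, hind (symmDiff base A), hind A, ← Finset.sum_add_distrib]
    refine Finset.sum_congr rfl fun p _ => ?_
    by_cases hA : p ∈ A <;> by_cases hb : bit p.2 = true <;>
      simp [Finset.mem_symmDiff, hmem_base, flipWeight, hwt, hA, hb]
  clear_value V wt
  have hcompl : ∀ A : Finset (Fin (t + 1) × E), ∑ p ∈ (symmDiff base A)ᶜ, (wt p : ℝ)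
      = V - ((∑ p ∈ A, flipWeight bit p : ℤ) : ℝ) := by
    intro A
    have h1 := Finset.sum_add_sum_compl (symmDiff base A) fun p => (wt p : ℝ)
    rw [hmemsum, hsum] at h1
    linarith
  have hbound : ∀ A : Finset (Fin (t + 1) × E), |∑ p ∈ A, flipWeight bit p| ≤ (d : ℤ) →
      |((∑ p ∈ A, flipWeight bit p : ℤ) : ℝ)| ≤ d := by
    intro A hA
    exact_mod_cast hA
  -- The weight deviates by at most d from its balanced value while V ≥ 2 ^ t; with d * n ≤ 2 ^ t
  -- this gives ρ ^ n ≤ e < 3.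
  obtain ⟨ρ, hρ⟩ : ∃ ρ : ℝ, ρ = 1 + d / 2 ^ t := ⟨_, rfl⟩
  have hdρ : (d : ℝ) ≤ (ρ - 1) * V := by
    have : (d : ℝ) = (ρ - 1) * 2 ^ t := by rw [hρ]; field_simp; ring
    rw [this]
    exact mul_le_mul_of_nonneg_left hV2 (by rw [hρ, add_sub_cancel_left]; positivity)
  have hs0 : (0 : ℝ) < s := by linarith
  have h := corrects_of_interpolation (G := G) hS
    (Sigma.fst : (Σ p : Fin (t + 1) × E, Fin (wt p)) → Fin (t + 1) × E) Z (d := d) ?_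
    (ρ := ρ) (by rw [hρ]; positivity) ?_ ?_ n δ
  · refine h.mono hZc ?_
    have hρn : ρ ^ n ≤ 3 := by
      have h1 : ρ ≤ Real.exp (d / 2 ^ t) := by
        rw [hρ, add_comm]; exact Real.add_one_le_exp _
      calc ρ ^ n ≤ Real.exp (d / 2 ^ t) ^ n := pow_le_pow_left₀ (by rw [hρ]; positivity) h1 n
        _ = Real.exp (n * (d / 2 ^ t)) := (Real.exp_nat_mul _ _).symm
        _ ≤ Real.exp 1 := by
            rw [Real.exp_le_exp, mul_div_assoc', div_le_one (by positivity)]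
            calc (n : ℝ) * d = ((d * n : ℕ) : ℝ) := by push_cast; ring
              _ ≤ ((2 ^ t : ℕ) : ℝ) := by exact_mod_cast ht
              _ = 2 ^ t := by push_cast; ring
        _ ≤ 3 := Real.exp_one_lt_three.le
    have hρ0 : 0 ≤ ρ := by rw [hρ]; positivity
    have hZc' : (Z.card : ℝ) ≤ N := by exact_mod_cast hZc
    gcongr
  · intro q hq hq0
    have h1 := (hq.comp_symmDiff base).eq_zero_of_conf (bit := bit) ∅ ?_ ?_ (J := base)
      (Finset.disjoint_empty_right _)
    · rwa [symmDiff_self] at h1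
    · intro b
      rw [Finset.card_empty, zero_add]
      exact hbit b
    · intro A hA
      exact hq0 _ (Finset.mem_image_of_mem _ (Finset.mem_filter.mpr
        ⟨hZ₀ _ _ hA, hA.abs_sum_flipWeight_le⟩))
  · intro A' hA'
    obtain ⟨A, hA, rfl⟩ := Finset.mem_image.mp hA'
    have h1 := abs_le.mp (hbound A (Finset.mem_filter.mp hA).2)
    have h2 := pr_sigma_fst_mem wt (symmDiff base A)ᶜ
    simp only [Finset.mem_compl] at h2
    rw [h2, hcompl, hsum, div_le_div_iff₀ (mul_pos hVpos hs0) hs0]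
    nlinarith
  · intro A' hA'
    obtain ⟨A, hA, rfl⟩ := Finset.mem_image.mp hA'
    have h1 := abs_le.mp (hbound A (Finset.mem_filter.mp hA).2)
    rw [pr_sigma_fst_mem wt (symmDiff base A), hmemsum, hsum, div_mul_eq_mul_div,
      div_le_div_iff₀ (mul_pos hVpos hs0) hs0]
    have h3 : (ρ - 1) * V ≤ (ρ - 1) * V * (s - 1) :=
      le_mul_of_one_le_right (by linarith) hs1
    nlinarith

/-- The instance of `corrects_of_conf` with `3 * d` positions for each letter at each scale. -/
lemma corrects_of_le_two_pow {S : Type u} {G : Type v} [Fintype S] [AddCommGroup S]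
    [AddCommGroup G] (hS : 2 ≤ Fintype.card S) {d n t : ℕ} (hd : 0 < d) (ht : d * n ≤ 2 ^ t)
    {δ : ℝ} (hδ : 0 ≤ δ) :
    Corrects S G n d (((t + 1) * (3 * d * Fintype.card S) ^ 3 + 1) ^ d) δ
      ((((t + 1) * (3 * d * Fintype.card S) ^ 3 + 1) ^ d : ℕ) * (3 * δ)) := by
  classical
  have hE : Fintype.card (Fin (3 * d) × S) = 3 * d * Fintype.card S := by simp
  have hprod : ∀ b, (Finset.univ.filter fun e : Fin (3 * d) × S => decide (e.2 ≠ 0) = b).card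
      = 3 * d * (Finset.univ.filter fun c : S => decide (c ≠ 0) = b).card := by
    intro b
    have : (Finset.univ.filter fun e : Fin (3 * d) × S => decide (e.2 ≠ 0) = b)
        = Finset.univ ×ˢ (Finset.univ.filter fun c : S => decide (c ≠ 0) = b) := by
      ext e; simp
    rw [this, Finset.card_product, Finset.card_univ, Fintype.card_fin]
  have hfalse : (Finset.univ.filter fun c : S => decide (c ≠ 0) = false).card = 1 := by
    have : (Finset.univ.filter fun c : S => decide (c ≠ 0) = false) = {0} := by
      ext c; simp
    rw [this, Finset.card_singleton]
  have htrue : (Finset.univ.filter fun c : S => decide (c ≠ 0) = true).card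
      = Fintype.card S - 1 := by
    simp [Finset.filter_ne', Finset.card_erase_of_mem]
  rw [← hE]
  refine corrects_of_conf hS hd ht (fun e : Fin (3 * d) × S => decide (e.2 ≠ 0)) ?_ ?_ hδ
  · intro b
    rw [hprod]
    refine Nat.le_mul_of_pos_right _ ?_
    cases b
    · rw [hfalse]; exact one_pos
    · rw [htrue]; omega
  · rw [hprod, hprod, hfalse, htrue, mul_one]

end Logarithmic

end JuntaCorrection

/-! ### Assembling the stages and making the constants uniform. -/

namespace JuntaCorrection

lemma exists_corrects_const (s d M : ℕ) (hs : 2 ≤ s) (hM : 0 < M) {ε : ℝ} (hε : 0 < ε) :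
    ∃ q : ℕ, ∀ (S : Type u) [Fintype S] [AddCommGroup S], Fintype.card S = s →
      ∀ (G : Type v) [AddCommGroup G], (∀ g : G, M • g = 0) → ∀ n : ℕ,
        Corrects S G n d q (1 / (s : ℝ) ^ d / 2 - ε) (1 / 4) := by
  obtain ⟨N, hN, h⟩ := exists_corrects_torsion.{u, v} s d M hs hM
  have hN0 : (0 : ℝ) < N := by exact_mod_cast hN
  obtain ⟨q, hq⟩ := exists_reduces_const.{u, v} s d hs hε (η := 1 / (8 * N)) (θ := 1 / 8)
    (by positivity) (by norm_num)
  refine ⟨q * N, fun S _ _ hS G _ hG n => ?_⟩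
  refine ((hq S hS G n).corrects (h S hS G hG n _ (by positivity)) (by positivity)).mono le_rfl ?_
  have : (N : ℝ) * (1 / (8 * N)) = 1 / 8 := by field_simp
  rw [this]
  norm_num

lemma exists_scale (d n : ℕ) (hd : 0 < d) :
    ∃ t : ℕ, d * n ≤ 2 ^ t ∧ (t + 1 : ℝ) ≤ (4 + 2 * d) * max 1 (Real.log n) := by
  set x := (Real.log d + Real.log n) / Real.log 2 with hx
  have hd1 : (1 : ℝ) ≤ d := by exact_mod_cast hd
  have hld : 0 ≤ Real.log d := Real.log_nonneg hd1
  have hln : 0 ≤ Real.log n := Real.log_natCast_nonneg n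
  have hl2 : (1 / 2 : ℝ) < Real.log 2 := by linarith [Real.log_two_gt_d9]
  have hx0 : 0 ≤ x := by positivity
  refine ⟨⌈x⌉₊, ?_, ?_⟩
  · rcases Nat.eq_zero_or_pos n with rfl | hn
    · simp
    have h1 : Real.log ((d * n : ℕ) : ℝ) ≤ Real.log ((2 ^ ⌈x⌉₊ : ℕ) : ℝ) := by
      push_cast
      rw [Real.log_mul (by positivity) (by positivity), Real.log_pow,
        ← div_le_iff₀ (by linarith)]
      exact Nat.le_ceil x
    have h2 := (Real.log_le_log_iff (by positivity) (by positivity)).mp h1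
    exact_mod_cast h2
  · have h1 := (Nat.ceil_lt_add_one hx0).le
    have h2 : x ≤ 2 * (Real.log d + Real.log n) := by
      rw [hx, div_le_iff₀ (by linarith)]
      nlinarith
    have h3 : Real.log d ≤ d := (Real.log_le_sub_one_of_pos (by positivity)).trans (by linarith)
    have h4 : Real.log n ≤ max 1 (Real.log n) := le_max_right _ _
    have h5 : (1 : ℝ) ≤ max 1 (Real.log n) := le_max_left _ _
    nlinarith

/-- Correction from the unique decoding radius with `O((log n) ^ d)` queries up to powers of
`log log n`. -/
lemma exists_corrects_polylog (s d : ℕ) (hs : 2 ≤ s) (hd : 0 < d) {ε : ℝ} (hε : 0 < ε) :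
    ∃ (C : ℝ) (c : ℕ), 0 ≤ C ∧ ∀ (S : Type u) [Fintype S] [AddCommGroup S], Fintype.card S = s →
      ∀ (G : Type v) [AddCommGroup G] (n : ℕ), ∃ q : ℕ,
        (q : ℝ) ≤ C * max 1 (Real.log n) ^ d * max 1 (Real.log (Real.log n)) ^ c ∧
        Corrects S G n d q (1 / (s : ℝ) ^ d / 2 - ε) (1 / 4) := by
  obtain ⟨q₂, C₂, hq₂, hC₂, hred⟩ := exists_reduces_rpow.{u, v} s d hs
  -- The first term permits iteration; the second keeps its failure probability below 1/16. The
  -- three stages may fail with probability 1/16, 1/16 and 1/8.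
  set η : ℝ := min (1 / 2 ^ 16) ((1 / (32 * C₂)) ^ 4) with hη
  have hη0 : 0 < η := lt_min (by norm_num) (by positivity)
  have hη1 : η ≤ 1 / 2 ^ 16 := min_le_left _ _
  have hηC : 2 * C₂ * η ^ (1 / 4 : ℝ) ≤ 1 / 16 := by
    have h1 : η ^ (1 / 4 : ℝ) ≤ 1 / (32 * C₂) := by
      refine (Real.rpow_le_rpow hη0.le (min_le_right _ _) (by norm_num)).trans_eq ?_
      rw [← Real.rpow_natCast, ← Real.rpow_mul (by positivity)]
      norm_num
    calc 2 * C₂ * η ^ (1 / 4 : ℝ) ≤ 2 * C₂ * (1 / (32 * C₂)) := by gcongr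
      _ = 1 / 16 := by field_simp; norm_num
  have hlogη : 1 ≤ Real.log (1 / η) := by
    rw [Real.le_log_iff_exp_le (by positivity)]
    have : (3 : ℝ) ≤ 1 / η := by
      rw [le_div_iff₀ hη0]; linarith [show (3 : ℝ) * (1 / 2 ^ 16) ≤ 1 by norm_num]
    linarith [Real.exp_one_lt_three]
  obtain ⟨q₁, hq₁⟩ := exists_reduces_const.{u, v} s d hs hε hη0 (θ := 1 / 16) (by norm_num)
  -- Since q₂ < (5/4)^c, the cost of T + 1 rounds is at most the c-th power of (5/4)^(T+1), hence of
  -- order (log N)^c, a power of log log n.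
  obtain ⟨c, hc⟩ := pow_unbounded_of_one_lt (q₂ : ℝ) (show (1 : ℝ) < 5 / 4 by norm_num)
  set A : ℕ := (3 * d * s) ^ 3 with hA
  set K : ℝ := (4 + 2 * d) * A + 1 with hK
  have hK1 : 1 ≤ K := by rw [hK]; have : (0 : ℝ) ≤ (4 + 2 * d) * A := by positivity
                         linarith
  have hKd : 1 ≤ K ^ d := one_le_pow₀ hK1
  have hlogK : 0 ≤ Real.log (24 * K ^ d) := Real.log_nonneg (by linarith)
  set K₃ : ℝ := Real.log (24 * K ^ d) + d + 1 with hK₃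
  refine ⟨q₁ * (5 / 4 * K₃) ^ c * K ^ d, c, by positivity, fun S _ _ hS G _ n => ?_⟩
  set l := max 1 (Real.log n) with hl
  set ll := max 1 (Real.log (Real.log n)) with hll
  have hl1 : 1 ≤ l := le_max_left _ _
  have hll1 : 1 ≤ ll := le_max_left _ _
  have hlogl : Real.log l ≤ ll := by
    rcases le_total (Real.log n) 1 with h | h
    · rw [hl, max_eq_left h, Real.log_one]; linarith
    · rw [hl, max_eq_right h]; exact le_max_right _ _
  obtain ⟨t, ht, htl⟩ := exists_scale d n hd
  set N : ℕ := ((t + 1) * A + 1) ^ d with hN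
  have hNpos : 0 < N := by positivity
  have hN1 : (1 : ℝ) ≤ N := by exact_mod_cast hNpos
  have hNK : (N : ℝ) ≤ K ^ d * l ^ d := by
    rw [hN, ← mul_pow]
    push_cast
    gcongr
    calc (t + 1 : ℝ) * A + 1 ≤ (4 + 2 * d) * l * A + l := by gcongr
      _ = K * l := by rw [hK]; ring
  set Y : ℝ := Real.log (24 * N) with hY
  have hYK : Y ≤ K₃ * ll := by
    calc Y ≤ Real.log (24 * K ^ d * l ^ d) := by
          apply Real.log_le_log (by positivity); rw [mul_assoc]; gcongr
      _ = Real.log (24 * K ^ d) + d * Real.log l := by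
          rw [Real.log_mul (by positivity) (by positivity), Real.log_pow]
      _ ≤ Real.log (24 * K ^ d) * ll + d * ll := by
          gcongr
          exact le_mul_of_one_le_right hlogK hll1
      _ ≤ K₃ * ll := by rw [hK₃]; nlinarith
  have hY1 : 1 ≤ Y := by
    rw [hY, Real.le_log_iff_exp_le (by positivity)]
    linarith [Real.exp_one_lt_three]
  -- T + 1 rounds bring the distance to η^((5/4)^(T+1)) ≤ exp (-Y) = 1 / (24 N), since log (1/η) ≥
  -- 1.
  obtain ⟨T, hT1, hT2⟩ := exists_nat_pow_near hY1 (show (1 : ℝ) < 5 / 4 by norm_num)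
  refine ⟨q₁ * (q₂ ^ (T + 1) * N), ?_, ?_⟩
  · have h1 : (q₂ : ℝ) ^ (T + 1) ≤ (5 / 4 * K₃) ^ c * ll ^ c := by
      calc (q₂ : ℝ) ^ (T + 1) ≤ ((5 / 4 : ℝ) ^ c) ^ (T + 1) := by gcongr
        _ = (5 / 4 * (5 / 4) ^ T) ^ c := by rw [← pow_succ', ← pow_mul, ← pow_mul, mul_comm]
        _ ≤ (5 / 4 * (K₃ * ll)) ^ c := by gcongr; exact hT1.trans hYK
        _ = (5 / 4 * K₃) ^ c * ll ^ c := by rw [← mul_assoc, mul_pow]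
    push_cast
    calc (q₁ : ℝ) * ((q₂ : ℝ) ^ (T + 1) * N)
        ≤ q₁ * (((5 / 4 * K₃) ^ c * ll ^ c) * (K ^ d * l ^ d)) := by gcongr
      _ = _ := by ring
  · set δ : ℝ := η ^ ((5 / 4 : ℝ) ^ (T + 1)) with hδ
    have hδ0 : 0 ≤ δ := by positivity
    have hδN : (N : ℝ) * (3 * δ) ≤ 1 / 8 := by
      have h1 : δ ≤ 1 / (24 * N) := by
        rw [← Real.log_le_log_iff (by positivity) (by positivity), hδ, Real.log_rpow hη0,
          one_div, Real.log_inv, ← hY]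
        rw [one_div, Real.log_inv] at hlogη
        nlinarith [show (0 : ℝ) < (5 / 4) ^ (T + 1) by positivity]
      calc (N : ℝ) * (3 * δ) ≤ N * (3 * (1 / (24 * N))) := by gcongr
        _ = 1 / 8 := by field_simp; norm_num
    have h3 := corrects_of_le_two_pow (G := G) (hS.symm ▸ hs : 2 ≤ Fintype.card S) hd ht hδ0
    rw [hS] at h3
    have h2 := Reduces.iterate hC₂ (hred S hS G n) (T + 1) hη0 hη1
    have h4 := (hq₁ S hS G n).corrects (h2.corrects h3 (by positivity)) (by positivity)
    refine h4.mono le_rfl ?_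
    rw [← hA, ← hN]
    linarith

lemma locallyCorrectable_of_neg {D G : Type*} [Fintype D] [Nonempty G] (F : Set (D → G)) {δ : ℝ}
    (hδ : δ < 0) (q : ℕ) : LocallyCorrectable F q δ :=
  locallyCorrectable_of_local (Ω := Unit) (fun _ _ _ => Classical.arbitrary G)
    (fun _ _ => ⟨∅, by simp, fun _ _ _ => rfl⟩)
    fun _ _ _ h => absurd (h.trans_lt hδ) (not_lt.mpr (pr_nonneg _))

/-- Juntas ignore any structure on S; a cyclic group is transported only to allow translations. -/
lemma exists_addCommGroup (S : Type u) [Fintype S] (hS : 2 ≤ Fintype.card S) :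
    Nonempty (AddCommGroup S) := by
  have : NeZero (Fintype.card S) := ⟨by omega⟩
  exact ⟨(Fintype.equivOfCardEq (ZMod.card (Fintype.card S)).symm).addCommGroup⟩

/-- For s ≥ 2 and d > 0, s^d is at least s and at least d. So only finitely many pairs (s, d) have a
nonnegative radius, apart from d = 0. -/
lemma radius_neg {ε : ℝ} {m s d : ℕ} (hm : 1 / ε < m) (hε : 0 < ε) (hs : 2 ≤ s) (hd : 0 < d)
    (h : m ≤ s ∨ m ≤ d) : 1 / (s : ℝ) ^ d / 2 - ε < 0 := by
  have h1 : m ≤ s ^ d := by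
    rcases h with h | h
    · exact h.trans (Nat.le_self_pow hd.ne' s)
    · exact h.trans ((Nat.lt_pow_self (by omega)).le)
  have h2 : 1 / ε < (s : ℝ) ^ d := hm.trans_le (by exact_mod_cast h1)
  have h3 : (0 : ℝ) < (s : ℝ) ^ d := lt_trans (by positivity) h2
  rw [div_lt_iff₀ hε] at h2
  have h4 : 1 / (s : ℝ) ^ d < ε := by rw [div_lt_iff₀ h3]; linarith
  have h5 : 0 < 1 / (s : ℝ) ^ d := by positivity
  linarith

lemma exists_locallyCorrectable_zero {ε : ℝ} (hε : 0 < ε) :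
    ∃ q : ℕ, ∀ (S : Type u) [Fintype S], 2 ≤ Fintype.card S → ∀ (G : Type v) [AddCommGroup G]
      (n : ℕ), LocallyCorrectable (juntaSums S G n 0) q (1 / (Fintype.card S : ℝ) ^ 0 / 2 - ε) := by
  obtain ⟨m, hm⟩ := exists_nat_gt (4 / ε ^ 2)
  have hm0 : (0 : ℝ) < m := lt_trans (by positivity) hm
  rw [div_lt_iff₀ (by positivity)] at hm
  refine ⟨m, fun S _ hS G _ n => ?_⟩
  have : Nonempty S := Fintype.card_pos_iff.mp (by omega)
  have := corrects_zero (S := S) (G := G) n hε (m := m) (by exact_mod_cast hm0) hm.le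
  simpa using this.locallyCorrectable

end JuntaCorrection

open JuntaCorrection in
theorem theorem5p4 (ε : ℝ) (hε : 0 < ε) :
    (∃ (C : ℝ) (c : ℕ), ∀ (S : Type u) [Fintype S], 2 ≤ Fintype.card S →
      ∀ (G : Type v) [AddCommGroup G] (d n : ℕ), ∃ q : ℕ,
        (q : ℝ) ≤ C * (max 1 (Real.log n)) ^ d * (max 1 (Real.log (Real.log n))) ^ c ∧
        LocallyCorrectable (juntaSums S G n d) q
          (1 / (Fintype.card S : ℝ) ^ d / 2 - ε)) ∧
    (∀ M : ℕ, 0 < M → ∃ q : ℕ, ∀ (S : Type u) [Fintype S], 2 ≤ Fintype.card S →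
      ∀ (G : Type v) [AddCommGroup G], AddMonoid.exponent G = M → ∀ d n : ℕ,
        LocallyCorrectable (juntaSums S G n d) q
          (1 / (Fintype.card S : ℝ) ^ d / 2 - ε)) := by
  classical
  obtain ⟨m, hm⟩ := exists_nat_gt (1 / ε)
  obtain ⟨q₀, hq₀⟩ := exists_locallyCorrectable_zero.{u, v} hε
  constructor
  · have key : ∀ s d : ℕ, ∃ (C : ℝ) (c : ℕ), 0 ≤ C ∧ (2 ≤ s → 0 < d →
        ∀ (S : Type u) [Fintype S] [AddCommGroup S], Fintype.card S = s →
        ∀ (G : Type v) [AddCommGroup G] (n : ℕ), ∃ q : ℕ,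
          (q : ℝ) ≤ C * max 1 (Real.log n) ^ d * max 1 (Real.log (Real.log n)) ^ c ∧
          Corrects S G n d q (1 / (s : ℝ) ^ d / 2 - ε) (1 / 4)) := by
      intro s d
      by_cases h : 2 ≤ s ∧ 0 < d
      · obtain ⟨C, c, hC, hcor⟩ := exists_corrects_polylog.{u, v} s d h.1 h.2 hε
        exact ⟨C, c, hC, fun _ _ => hcor⟩
      · exact ⟨0, 0, le_rfl, fun h1 h2 => absurd ⟨h1, h2⟩ h⟩
    choose C c hC hcor using key
    -- Summing over the finitely many relevant pairs (s, d) dominates each individual constant.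
    refine ⟨q₀ + ∑ x ∈ Finset.range m ×ˢ Finset.range m, C x.1 x.2,
      ∑ x ∈ Finset.range m ×ˢ Finset.range m, c x.1 x.2, fun S _ hS G _ d n => ?_⟩
    have hsum : 0 ≤ ∑ x ∈ Finset.range m ×ˢ Finset.range m, C x.1 x.2 :=
      Finset.sum_nonneg fun x _ => hC _ _
    have hl1 : 1 ≤ max 1 (Real.log n) := le_max_left _ _
    have hll1 : 1 ≤ max 1 (Real.log (Real.log n)) := le_max_left _ _
    rcases Nat.eq_zero_or_pos d with rfl | hd
    · refine ⟨q₀, ?_, hq₀ S hS G n⟩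
      rw [pow_zero, mul_one]
      have h1 := one_le_pow₀ hll1 (n := ∑ x ∈ Finset.range m ×ˢ Finset.range m, c x.1 x.2)
      have h2 : (0 : ℝ) ≤ q₀ := by positivity
      nlinarith
    by_cases hsm : m ≤ Fintype.card S ∨ m ≤ d
    -- A negative radius admits no oracle, so no query is needed.
    · exact ⟨0, by push_cast; positivity, locallyCorrectable_of_neg _ (radius_neg hm hε hS hd hsm) _⟩
    push Not at hsm
    have hmem : (Fintype.card S, d) ∈ Finset.range m ×ˢ Finset.range m := by simpa using hsm
    obtain ⟨_⟩ := exists_addCommGroup S hS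
    obtain ⟨q, hq, hqc⟩ := hcor (Fintype.card S) d hS hd S rfl G n
    refine ⟨q, hq.trans ?_, hqc.locallyCorrectable⟩
    have h1 := Finset.single_le_sum (f := fun x : ℕ × ℕ => C x.1 x.2)
      (fun x _ => hC x.1 x.2) hmem
    have h2 := Finset.single_le_sum (f := fun x : ℕ × ℕ => c x.1 x.2)
      (fun x _ => Nat.zero_le _) hmem
    have h3 : (0 : ℝ) ≤ q₀ := by positivity
    have h4 : C (Fintype.card S) d ≤ q₀ + ∑ x ∈ Finset.range m ×ˢ Finset.range m, C x.1 x.2 := by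
      simp only at h1
      linarith
    have h5 := pow_le_pow_right₀ hll1 h2
    have h6 : 0 ≤ (q₀ : ℝ) + ∑ x ∈ Finset.range m ×ˢ Finset.range m, C x.1 x.2 := by positivity
    gcongr
  · intro M hM
    have key : ∀ s d : ℕ, ∃ q : ℕ, 2 ≤ s →
        ∀ (S : Type u) [Fintype S] [AddCommGroup S], Fintype.card S = s →
        ∀ (G : Type v) [AddCommGroup G], (∀ g : G, M • g = 0) → ∀ n : ℕ,
          Corrects S G n d q (1 / (s : ℝ) ^ d / 2 - ε) (1 / 4) := by
      intro s d
      by_cases h : 2 ≤ s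
      · obtain ⟨q, hq⟩ := exists_corrects_const.{u, v} s d M h hM hε
        exact ⟨q, fun _ => hq⟩
      · exact ⟨0, fun h' => absurd h' h⟩
    choose q hq using key
    refine ⟨q₀ + ∑ x ∈ Finset.range m ×ˢ Finset.range m, q x.1 x.2, fun S _ hS G _ hG d n => ?_⟩
    have hG' : ∀ g : G, M • g = 0 := fun g => hG ▸ AddMonoid.exponent_nsmul_eq_zero g
    have mono : ∀ {q q' : ℕ} {F : Set ((Fin n → S) → G)} {δ : ℝ}, q ≤ q' →
        LocallyCorrectable F q δ → LocallyCorrectable F q' δ := by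
      rintro q q' F δ hqq ⟨A, hA, h⟩
      exact ⟨A, fun x T hT => makesAtMost_mono (hA x T hT) hqq, h⟩
    rcases Nat.eq_zero_or_pos d with rfl | hd
    · exact mono (Nat.le_add_right _ _) (hq₀ S hS G n)
    by_cases hsm : m ≤ Fintype.card S ∨ m ≤ d
    · exact locallyCorrectable_of_neg _ (radius_neg hm hε hS hd hsm) _
    push Not at hsm
    have hmem : (Fintype.card S, d) ∈ Finset.range m ×ˢ Finset.range m := by simpa using hsm
    obtain ⟨_⟩ := exists_addCommGroup S hS
    refine mono ?_ (hq (Fintype.card S) d hS S rfl G hG' n).locallyCorrectable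
    have h2 := Finset.single_le_sum (f := fun x : ℕ × ℕ => q x.1 x.2)
      (fun x _ => Nat.zero_le _) hmem
    exact h2.trans (Nat.le_add_left _ _)
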